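/- Let $G$ be a second-countable, unimodular, locally compact (Hausdorff) group with Haar measure $\mu$. A strong Følner sequence is a sequence $(K_n)$ of non-null compact subsets of $G$ such that, for every non-empty compact $C\subseteq G$, $\mu(K_nC\,\triangle\,K_n)/\mu(K_n)\to 0$ and $\mu(K_nC\cap K_n^cC)/\mu(K_n)\to 0$. Fix a strong Følner sequence $(K_n)$ (so $G$ is amenable) with $K_n\subseteq K_{n+1}$ and $\bigcup_n K_n=G$, and a compact symmetric unit neighbourhood $Q\subseteq G$. Let $\pi$ be a discrete series representation of $G$ on a complex Hilbert space $\mathcal H$, i.e. an irreducible strongly measurable projective unitary representation, $\pi(xy)=\sigma(x,y)\pi(x)\pi(y)$ with $\sigma:G\times G\to\mathbb T$, such that $\int_G|\langle u,\pi(x)u\rangle|^2\,d\mu(x)<\infty$ for some $u\neq 0$. Its formal degree $d_\pi>0$ is the number with $$\int_G\langle f_1,\pi(x)g_1\rangle\langle\pi(x)g_2,f_2\rangle\,d\mu(x)=d_\pi^{-1}\langle f_1,f_2\rangle\overline{\langle g_1,g_2\rangle}\qquad(f_1,f_2,g_1,g_2\in\mathcal H).$$ Let $g\in\mathcal B^2_\pi$,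 i.e. the function $V_gg(x)=\langle g,\pi(x)g\rangle$ satisfies $\int_G \operatorname{ess\,sup}_{z\in Q}|V_gg(xz)|^2\,d\mu(x)<\infty$. Let $\Lambda\subseteq G$ be discrete and suppose that $\pi(\Lambda)g=(\pi(\lambda)g)_{\lambda\in\Lambda}$ is a frame for $\mathcal H$, with frame operator $Sf=\sum_{\lambda\in\Lambda}\langle f,\pi(\lambda)g\rangle\pi(\lambda)g$ and canonical dual frame $h_\lambda=S^{-1}\pi(\lambda)g$. Then the formal degree $d_\pi$ exists; the lower and upper Beurling densities $$D^-(\Lambda)=\lim_{n\to\infty}\inf_{x\in G}\frac{\#(\Lambda\cap xL_n)}{\mu(L_n)},\qquad D^+(\Lambda)=\lim_{n\to\infty}\sup_{x\in G}\frac{\#(\Lambda\cap xL_n)}{\mu(L_n)}$$ exist for every strong Følner sequence $(L_n)$, do not depend on it, and satisfy $0<D^-(\Lambda)\le D^+(\Lambda)<\infty$; and the lower and upper frame measures $$M^-=\lim_{n\to\infty}\inf_{x\in G}\frac1{\#(\Lambda\cap xK_n)}\sum_{\lambda\in\Lambda\cap xK_n}\langle\pi(\lambda)g,h_\lambda\rangle,\qquad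 M^+=\lim_{n\to\infty}\sup_{x\in G}\frac1{\#(\Lambda\cap xK_n)}\sum_{\lambda\in\Lambda\cap xK_n}\langle\pi(\lambda)g,h_\lambda\rangle$$ exist and satisfy $$M^-=\frac{d_\pi}{D^+(\Lambda)},\qquad M^+=\frac{d_\pi}{D^-(\Lambda)}.$$ -/

import Mathlib

open MeasureTheory Filter Topology
open scoped ENNReal NNReal Pointwise symmDiff ComplexConjugate

noncomputable section

namespace CoherentFrame

/-! Mathlib's `inner ℂ u v` is linear in `v`; the inner product `⟨u, v⟩` that is linear in its
first argument is therefore `inner ℂ v u`. -/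

/-! ### Følner sequences -/

section Folner

variable {G : Type*} [Group G] [TopologicalSpace G] [MeasurableSpace G]

/-- (Right) Følner sequence: non-null compact sets with `μ (Kₙ C ∆ Kₙ) / μ (Kₙ) → 0` for every
(non-empty) compact set `C`. -/
structure IsFolner (μ : Measure G) (K : ℕ → Set G) : Prop where
  isCompact : ∀ n, IsCompact (K n)
  measure_ne_zero : ∀ n, μ (K n) ≠ 0
  tendsto_symmDiff : ∀ C : Set G, IsCompact C → C.Nonempty →
    Tendsto (fun n => μ ((K n * C) ∆ K n) / μ (K n)) atTop (𝓝 0)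

/-- (Right) strong Følner sequence. -/
structure IsStrongFolner (μ : Measure G) (K : ℕ → Set G) : Prop extends IsFolner μ K where
  tendsto_boundary : ∀ C : Set G, IsCompact C →
    Tendsto (fun n => μ ((K n * C) ∩ ((K n)ᶜ * C)) / μ (K n)) atTop (𝓝 0)

/-- The nesting and covering property `Kₙ ⊆ Kₙ₊₁`, `G = ⋃ₙ Kₙ`. -/
def IsNestedCover (K : ℕ → Set G) : Prop :=
  (∀ n, K n ⊆ K (n + 1)) ∧ ⋃ n, K n = Set.univ

/-! ### Beurling densities -/

/-- `D` is the lower Beurling density of `Λ`: for every strong Følner sequence the limit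
of `inf_x #(Λ ∩ x Kₙ) / μ(Kₙ)` exists and equals `D`. -/
def HasLowerBeurlingDensity (μ : Measure G) (Λ : Set G) (D : ℝ≥0∞) : Prop :=
  ∀ K : ℕ → Set G, IsStrongFolner μ K →
    Tendsto (fun n => ⨅ x : G, ((Λ ∩ x • K n).encard : ℝ≥0∞) / μ (K n)) atTop (𝓝 D)

/-- `D` is the upper Beurling density of `Λ`: for every strong Følner sequence the limit
of `sup_x #(Λ ∩ x Kₙ) / μ(Kₙ)` exists and equals `D`. -/
def HasUpperBeurlingDensity (μ : Measure G) (Λ : Set G) (D : ℝ≥0∞) : Prop :=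
  ∀ K : ℕ → Set G, IsStrongFolner μ K →
    Tendsto (fun n => ⨆ x : G, ((Λ ∩ x • K n).encard : ℝ≥0∞) / μ (K n)) atTop (𝓝 D)

/-! ### Wiener amalgam spaces -/

/-- The left-sided local maximal function `M^L F (x) = ess sup_{z ∈ Q} |F (x z)|`. -/
def localMaximal (μ : Measure G) (Q : Set G) (F : G → ℂ) (x : G) : ℝ≥0∞ :=
  essSup (fun z => ‖F (x * z)‖ₑ) (μ.restrict Q)

/-- Membership in the left-sided Wiener amalgam space `W^L(L^p)`: `F` is measurable and locally
essentially bounded, and its local maximal function is `p`-integrable. -/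
structure MemWienerAmalgam (μ : Measure G) (Q : Set G) (p : ℝ) (F : G → ℂ) : Prop where
  aestronglyMeasurable : AEStronglyMeasurable F μ
  locallyBounded : ∀ C : Set G, IsCompact C → essSup (fun x => ‖F x‖ₑ) (μ.restrict C) < ∞
  lintegral_lt_top : ∫⁻ x, localMaximal μ Q F x ^ p ∂μ < ∞

end Folner

/-! ### Frames -/

section Frame

variable {ι H : Type*} [NormedAddCommGroup H] [InnerProductSpace ℂ H]

/-- The family `e` is a frame for `H`. -/
def IsFrame (e : ι → H) : Prop :=
  ∃ A B : ℝ, 0 < A ∧ 0 < B ∧ ∀ f : H,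
    Summable (fun i => ‖inner ℂ (e i) f‖ ^ 2) ∧
    A * ‖f‖ ^ 2 ≤ ∑' i, ‖inner ℂ (e i) f‖ ^ 2 ∧
    ∑' i, ‖inner ℂ (e i) f‖ ^ 2 ≤ B * ‖f‖ ^ 2

/-- The frame operator `S f = ∑ i, ⟨f, e i⟩ e i`. -/
def frameOperator (e : ι → H) (f : H) : H := ∑' i, inner ℂ (e i) f • e i

/-- The canonical dual `h i = S⁻¹ (e i)`; the operator `S` is bijective when `e` is a frame of a
Hilbert space. -/
def canonicalDual (e : ι → H) (i : ι) : H := Function.invFun (frameOperator e) (e i)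

end Frame

/-! ### Projective unitary representations -/

/-- A projective unitary representation: a strongly measurable map `π` into the unitaries of `H`
with `π (x y) = σ (x, y) π x π y` for some function `σ : G × G → 𝕋`. -/
structure ProjectiveRep (G H : Type*) [Group G] [MeasurableSpace G]
    [NormedAddCommGroup H] [InnerProductSpace ℂ H] where
  toFun : G → (H ≃ₗᵢ[ℂ] H)
  stronglyMeasurable : ∀ f : H, StronglyMeasurable (fun x => toFun x f)
  exists_cocycle : ∃ σ : G × G → Circle, ∀ (x y : G) (f : H),
    toFun (x * y) f = (σ (x, y) : ℂ) • toFun x (toFun y f)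

namespace ProjectiveRep

variable {G H : Type*} [Group G] [TopologicalSpace G] [MeasurableSpace G]
  [NormedAddCommGroup H] [InnerProductSpace ℂ H]

instance : CoeFun (ProjectiveRep G H) (fun _ => G → (H ≃ₗᵢ[ℂ] H)) := ⟨ProjectiveRep.toFun⟩

/-- The coefficient transform `V_g f (x) = ⟨f, π(x) g⟩`. -/
def coeff (π : ProjectiveRep G H) (g f : H) (x : G) : ℂ := inner ℂ (π x g) f

/-- The only closed invariant subspaces are `{0}` and `H`. -/
def IsIrreducible (π : ProjectiveRep G H) : Prop :=
  ∀ W : Submodule ℂ H, IsClosed (W : Set H) → (∀ x : G, ∀ f ∈ W, π x f ∈ W) → W = ⊥ ∨ W = ⊤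

/-- Irreducible square-integrable representations. -/
def IsDiscreteSeries (π : ProjectiveRep G H) (μ : Measure G) : Prop :=
  π.IsIrreducible ∧ ∃ g : H, g ≠ 0 ∧ ∫⁻ x, ‖π.coeff g g x‖ₑ ^ 2 ∂μ < ∞

/-- `d > 0` is the formal degree of `π`: for all `f₁ f₂ g₁ g₂`,
`∫ ⟨f₁, π(x) g₁⟩ ⟨π(x) g₂, f₂⟩ dμ(x) = d⁻¹ ⟨f₁, f₂⟩ conj ⟨g₁, g₂⟩`, the integrals being
absolutely convergent. -/
def IsFormalDegree (π : ProjectiveRep G H) (μ : Measure G) (d : ℝ) : Prop :=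
  0 < d ∧ ∀ f₁ f₂ g₁ g₂ : H,
    Integrable (fun x => inner ℂ (π x g₁) f₁ * inner ℂ f₂ (π x g₂)) μ ∧
    ∫ x, inner ℂ (π x g₁) f₁ * inner ℂ f₂ (π x g₂) ∂μ
      = (d : ℂ)⁻¹ * inner ℂ f₂ f₁ * conj (inner ℂ g₂ g₁)

/-- `g ∈ 𝓑²_π`, that is, `V_g g ∈ W^L(L²)`. -/
def MemB2 (π : ProjectiveRep G H) (μ : Measure G) (Q : Set G) (g : H) : Prop :=
  MemWienerAmalgam μ Q 2 (π.coeff g g)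

/-- The coherent system `π(Λ) g = (π(λ) g)_{λ ∈ Λ}`. -/
def coherentSystem (π : ProjectiveRep G H) (Λ : Set G) (g : H) (l : Λ) : H := π l g

/-- `(#(Λ ∩ S))⁻¹ ∑_{λ ∈ Λ ∩ S} ⟨π(λ) g, h_λ⟩` with the canonical dual `(h_λ)`. The frame operator
being positive, the numbers `⟨π(λ) g, h_λ⟩` are real for a frame; the real part only changes the
type. -/
def frameAverage (π : ProjectiveRep G H) (Λ : Set G) (g : H) (S : Set G) : ℝ :=
  (∑ᶠ (l : Λ) (_ : (l : G) ∈ S),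
      (inner ℂ (canonicalDual (π.coherentSystem Λ g) l) (π l g)).re)
    / ((Λ ∩ S).ncard : ℝ)

/-- `M` is the lower frame measure of `π(Λ) g` along `K`. -/
def HasLowerFrameMeasure (π : ProjectiveRep G H) (Λ : Set G) (g : H) (K : ℕ → Set G)
    (M : ℝ) : Prop :=
  Tendsto (fun n => ⨅ x : G, π.frameAverage Λ g (x • K n)) atTop (𝓝 M)

/-- `M` is the upper frame measure of `π(Λ) g` along `K`. -/
def HasUpperFrameMeasure (π : ProjectiveRep G H) (Λ : Set G) (g : H) (K : ℕ → Set G)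
    (M : ℝ) : Prop :=
  Tendsto (fun n => ⨆ x : G, π.frameAverage Λ g (x • K n)) atTop (𝓝 M)

end ProjectiveRep

end CoherentFrame

end

/-! The frame measure formula is a trace computation localized to a Følner set. Consider the kernel
`c_l(y) = ⟨π(l)g, π(y)g⟩⟨π(y)g, h_l⟩` on `Λ × G`. For fixed `l`, orthogonality gives `∫ c_l =
d⁻¹‖g‖²⟨π(l)g, h_l⟩`. For fixed `y`, the reproducing formula applied to `π(y)g` gives `∑_l c_l(y) =
‖g‖²`. If both variables could be restricted to the same set `P = xKₙ` without loss, then `∑_{l ∈ P}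
⟨π(l)g, h_l⟩ = d μ(P)`. The loss comes from pairs with exactly one member in `P`. By Cauchy–Schwarz
it is controlled by tails of `V_g g` outside a compact `C`, sampled on `Λ` or integrated over `G`,
plus the pairs whose member in `P` lies in the `C`-boundary of `P` (`norm_sum_inner_sub_le`). The
amalgam condition makes the sampled tails uniformly small (`exists_isCompact_tail_le`), and the
strong Følner condition makes the boundary negligible, so the asymptotics hold uniformly in `x`
(`eventually_abs_sum_re_inner_sub_le`).

The frame average is therefore a numerator tending uniformly to `d` divided by `#(Λ ∩ xKₙ)/μ(Kₙ)`,
and its infimum and supremum converge once those of the denominator do (`tendsto_iInf_div`,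
`tendsto_iSup_div`). The densities exist by double counting against an arbitrary compact test set,
which identifies them with an infimum and a supremum not involving any sequence. They are finite
because the Bessel bound limits clustering, and positive because the lower frame bound forbids large
holes.

The formal degree comes from Schur's lemma applied to the graph of the coefficient transform.
Inversion invariance of the measure then makes the constant proportional to `‖g‖²`. -/

namespace CoherentFrame

/-! ### Beurling densities by double counting. -/

section Group

variable {G : Type*} [Group G] [TopologicalSpace G] [IsTopologicalGroup G] [T2Space G]
    [LocallyCompactSpace G] [SecondCountableTopology G] [MeasurableSpace G] [BorelSpace G]
    (μ : Measure G) [μ.IsHaarMeasure] [μ.IsMulRightInvariant]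

/-- A bi-invariant Haar measure is invariant under inversion. -/
theorem isInvInvariant_of_unimodular : μ.IsInvInvariant := by
  constructor
  let c : ℝ≥0∞ := Measure.haarScalarFactor μ.inv μ
  have hc : μ.inv = c • μ := Measure.isMulLeftInvariant_eq_smul_of_regular μ.inv μ
  have : Measure.map Inv.inv (Measure.map Inv.inv μ) = c ^ 2 • μ := by
    rw [← Measure.inv_def μ, hc, Measure.map_smul, ← Measure.inv_def μ, hc, smul_smul, pow_two]
  have μeq : μ = c ^ 2 • μ := by
    simpa [Measure.map_map continuous_inv.measurable continuous_inv.measurable]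
      using this
  have K : TopologicalSpace.PositiveCompacts G := Classical.arbitrary _
  have : c ^ 2 * μ K = 1 ^ 2 * μ K := by
    conv_rhs => rw [μeq]
    simp
  have : c ^ 2 = 1 ^ 2 :=
    (ENNReal.mul_left_inj (Measure.measure_pos_of_nonempty_interior _ K.interior_nonempty).ne'
          K.isCompact.measure_lt_top.ne).1 this
  have : c = 1 := (ENNReal.pow_right_strictMono two_ne_zero).injective this
  rw [hc, this, one_smul]

/-- Counting points of `Λ` in `y • L` and integrating over `y ∈ A`. -/
theorem setLIntegral_encard_inter_smul {G : Type*} [Group G] [TopologicalSpace G]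
    [IsTopologicalGroup G] [MeasurableSpace G] [BorelSpace G] (μ : Measure G) {Λ : Set G}
    (hΛ : Λ.Countable) {L : Set G} (hL : MeasurableSet L) (A : Set G) :
    ∫⁻ y in A, ((Λ ∩ y • L).encard : ℝ≥0∞) ∂μ = ∑' l : Λ, μ (A ∩ (l : G) • L⁻¹) := by
  have : Countable Λ := hΛ
  have h1 : ∀ y : G, ((Λ ∩ y • L).encard : ℝ≥0∞)
      = ∑' l : Λ, ((l : G) • L⁻¹).indicator (fun _ => (1 : ℝ≥0∞)) y := by
    intro y
    have h2 : ∀ l : Λ, ((l : G) • L⁻¹).indicator (fun _ => (1 : ℝ≥0∞)) y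
        = (Subtype.val ⁻¹' (y • L) : Set Λ).indicator (fun _ => (1 : ℝ≥0∞)) l := by
      intro l
      have h3 : y ∈ (l : G) • L⁻¹ ↔ l ∈ (Subtype.val ⁻¹' (y • L) : Set Λ) := by
        simp only [Set.mem_smul_set_iff_inv_smul_mem, smul_eq_mul, Set.mem_inv,
          mul_inv_rev, inv_inv, Set.mem_preimage]
      by_cases hl : l ∈ (Subtype.val ⁻¹' (y • L) : Set Λ)
      · rw [Set.indicator_of_mem hl, Set.indicator_of_mem (h3.2 hl)]
      · rw [Set.indicator_of_notMem hl, Set.indicator_of_notMem (mt h3.1 hl)]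
    rw [tsum_congr h2, ← tsum_subtype, ENNReal.tsum_set_one,
      ← Subtype.val_injective.encard_image, Subtype.image_preimage_coe]
  simp_rw [h1]
  rw [lintegral_tsum]
  · refine tsum_congr fun l => ?_
    rw [lintegral_indicator (hL.inv.const_smul _), setLIntegral_one,
      Measure.restrict_apply (hL.inv.const_smul _), Set.inter_comm]
  · intro l
    exact (measurable_const.indicator (hL.inv.const_smul _)).aemeasurable

/-- Double counting: integrate `#(Λ ∩ yL)` over `y ∈ xKL⁻¹`. Every `l ∈ Λ ∩ xK` has `lL⁻¹` wholly
inside that region, hence contributes `μ(L⁻¹) = μ(L)`; the last equality is where unimodularity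
enters. -/
theorem encard_inter_mul_le {Λ : Set G} (hΛ : Λ.Countable) (K : Set G) {L : Set G}
    (hL : IsCompact L) (x : G) :
    ((Λ ∩ x • K).encard : ℝ≥0∞) * μ L
      ≤ μ (K * L⁻¹) * ⨆ y : G, ((Λ ∩ y • L).encard : ℝ≥0∞) := by
  have := isInvInvariant_of_unimodular μ
  have h := setLIntegral_encard_inter_smul μ hΛ hL.measurableSet (x • (K * L⁻¹))
  calc ((Λ ∩ x • K).encard : ℝ≥0∞) * μ L
      = ∑' l : Λ, (Subtype.val ⁻¹' (x • K) : Set Λ).indicator (fun _ => μ L) l := by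
        rw [← tsum_subtype, ENNReal.tsum_set_const,
          ← Subtype.val_injective.encard_image, Subtype.image_preimage_coe]
    _ ≤ ∑' l : Λ, μ (x • (K * L⁻¹) ∩ (l : G) • L⁻¹) := by
        refine ENNReal.tsum_le_tsum fun l => ?_
        by_cases hl : l ∈ (Subtype.val ⁻¹' (x • K) : Set Λ)
        swap
        · rw [Set.indicator_of_notMem hl]
          exact zero_le
        rw [Set.indicator_of_mem hl]
        have hs : (l : G) • L⁻¹ ⊆ x • (K * L⁻¹) := by
          rw [← smul_mul_assoc]
          exact Set.smul_set_subset_mul hl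
        rw [Set.inter_eq_right.2 hs, measure_smul, Measure.measure_inv]
    _ = ∫⁻ y in x • (K * L⁻¹), ((Λ ∩ y • L).encard : ℝ≥0∞) ∂μ := h.symm
    _ ≤ ∫⁻ y in x • (K * L⁻¹), (⨆ y : G, ((Λ ∩ y • L).encard : ℝ≥0∞)) ∂μ :=
        lintegral_mono fun y => le_iSup (fun y : G => ((Λ ∩ y • L).encard : ℝ≥0∞)) y
    _ = _ := by rw [setLIntegral_const, measure_smul, mul_comm]

/-- The dual count, over the part of `xK` that `(xK)ᶜL⁻¹` does not reach. If `y` is there and `l ∈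
yL`, then `l ∈ xK`, for otherwise `y ∈ lL⁻¹ ⊆ (xK)ᶜL⁻¹`. -/
theorem mul_iInf_encard_inter_le {Λ : Set G} (hΛ : Λ.Countable) (K : Set G) {L : Set G}
    (hL : IsCompact L) (x : G) :
    μ (K \ (Kᶜ * L⁻¹)) * (⨅ y : G, ((Λ ∩ y • L).encard : ℝ≥0∞))
      ≤ ((Λ ∩ x • K).encard : ℝ≥0∞) * μ L := by
  have := isInvInvariant_of_unimodular μ
  have h := setLIntegral_encard_inter_smul μ hΛ hL.measurableSet (x • (K \ (Kᶜ * L⁻¹)))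
  calc μ (K \ (Kᶜ * L⁻¹)) * (⨅ y : G, ((Λ ∩ y • L).encard : ℝ≥0∞))
      = ∫⁻ y in x • (K \ (Kᶜ * L⁻¹)), (⨅ y : G, ((Λ ∩ y • L).encard : ℝ≥0∞)) ∂μ := by
        rw [setLIntegral_const, measure_smul, mul_comm]
    _ ≤ ∫⁻ y in x • (K \ (Kᶜ * L⁻¹)), ((Λ ∩ y • L).encard : ℝ≥0∞) ∂μ :=
        lintegral_mono fun y => iInf_le (fun y : G => ((Λ ∩ y • L).encard : ℝ≥0∞)) y
    _ = ∑' l : Λ, μ (x • (K \ (Kᶜ * L⁻¹)) ∩ (l : G) • L⁻¹) := h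
    _ ≤ ∑' l : Λ, (Subtype.val ⁻¹' (x • K) : Set Λ).indicator (fun _ => μ L) l := by
        refine ENNReal.tsum_le_tsum fun l => ?_
        by_cases hl : (l : G) ∈ x • K
        · rw [Set.indicator_of_mem (by exact hl)]
          calc _ ≤ μ ((l : G) • L⁻¹) := measure_mono Set.inter_subset_right
            _ = μ L := by rw [measure_smul, Measure.measure_inv]
        · rw [Set.indicator_of_notMem (by exact hl), nonpos_iff_eq_zero]
          convert measure_empty (μ := μ)
          rw [Set.eq_empty_iff_forall_notMem]
          rintro y ⟨hy, hy'⟩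
          rw [Set.mem_smul_set_iff_inv_smul_mem] at hy hy' hl
          refine hy.2 ⟨x⁻¹ • (l : G), hl, (l : G)⁻¹ • y, hy', ?_⟩
          simp [mul_assoc]
    _ = ((Λ ∩ x • K).encard : ℝ≥0∞) * μ L := by
        rw [← tsum_subtype, ENNReal.tsum_set_const,
          ← Subtype.val_injective.encard_image, Subtype.image_preimage_coe]

/-- The infimum over compact non-null `L` of `sup_y #(Λ ∩ y L) / μ(L)`. -/
noncomputable def upperDensity (Λ : Set G) : ℝ≥0∞ :=
  ⨅ (L : Set G) (_ : IsCompact L) (_ : μ L ≠ 0), ⨆ x : G, ((Λ ∩ x • L).encard : ℝ≥0∞) / μ L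

/-- The supremum over compact non-null `L` of `inf_y #(Λ ∩ y L) / μ(L)`. -/
noncomputable def lowerDensity (Λ : Set G) : ℝ≥0∞ :=
  ⨆ (L : Set G) (_ : IsCompact L) (_ : μ L ≠ 0), ⨅ x : G, ((Λ ∩ x • L).encard : ℝ≥0∞) / μ L

/-- Each `K n` competes in the infimum, which gives one inequality for every `n`. For the other,
count with a nearly optimal `L`: the Følner condition makes `μ(KₙL⁻¹)/μ(Kₙ)` asymptotically at most
`1`. -/
theorem hasUpperBeurlingDensity {Λ : Set G} (hΛ : Λ.Countable) :
    HasUpperBeurlingDensity μ Λ (upperDensity μ Λ) := by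
  intro K hK
  refine tendsto_order.2 ⟨fun a ha => Eventually.of_forall fun n => ha.trans_le ?_, fun b hb => ?_⟩
  · exact iInf₂_le_of_le (K n) (hK.isCompact n) (iInf_le _ (hK.measure_ne_zero n))
  · simp only [upperDensity, iInf_lt_iff] at hb
    obtain ⟨L, hL, hL0, hb⟩ := hb
    have hLne : L.Nonempty := nonempty_of_measure_ne_zero hL0
    have h1 := hK.tendsto_symmDiff L⁻¹ hL.inv hLne.inv
    have h2 : Tendsto (fun n => (1 + μ ((K n * L⁻¹) ∆ K n) / μ (K n)) *
        ⨆ x : G, ((Λ ∩ x • L).encard : ℝ≥0∞) / μ L) atTop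
        (𝓝 ((1 + 0) * ⨆ x : G, ((Λ ∩ x • L).encard : ℝ≥0∞) / μ L)) :=
      ENNReal.Tendsto.mul_const (h1.const_add 1) (Or.inl (by simp))
    rw [add_zero, one_mul] at h2
    filter_upwards [h2.eventually_lt_const hb] with n hn
    refine lt_of_le_of_lt (iSup_le fun x => ?_) hn
    have hKn0 := hK.measure_ne_zero n
    have hKnt := (hK.isCompact n).measure_ne_top (μ := μ)
    have hLt := hL.measure_ne_top (μ := μ)
    have h3 := encard_inter_mul_le μ hΛ (K n) hL x
    have h4 : μ (K n * L⁻¹) ≤ μ (K n) + μ ((K n * L⁻¹) ∆ K n) := by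
      refine (measure_mono ?_).trans (measure_union_le _ _)
      intro z hz
      by_cases h : z ∈ K n
      · exact Or.inl h
      · exact Or.inr (Or.inl ⟨hz, h⟩)
    rw [← ENNReal.iSup_div, ENNReal.div_le_iff hKn0 hKnt]
    have h5 : (1 + μ ((K n * L⁻¹) ∆ K n) / μ (K n)) * μ (K n)
        = μ (K n) + μ ((K n * L⁻¹) ∆ K n) := by
      rw [add_mul, one_mul, ENNReal.div_mul_cancel hKn0 hKnt]
    rw [mul_right_comm, h5, ← mul_div_assoc, ENNReal.le_div_iff_mul_le (Or.inl hL0) (Or.inl hLt)]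
    exact h3.trans (by gcongr)

theorem measure_le_measure_interior_add_boundary {G : Type*} [Group G] [MeasurableSpace G]
    (μ : Measure G) (K C : Set G) :
    μ K ≤ μ (K \ (Kᶜ * C)) + μ ((K * (C ∪ {1})) ∩ (Kᶜ * (C ∪ {1}))) := by
  refine (measure_mono ?_).trans (measure_union_le _ _)
  intro z hz
  by_cases h : z ∈ Kᶜ * C
  · exact Or.inr ⟨⟨z, hz, 1, by simp, by simp⟩, Set.mul_subset_mul_left Set.subset_union_left h⟩
  · exact Or.inl ⟨hz, h⟩

/-- Mirror image of the upper density, except that `K n` must be shrunk rather than thickened, which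
is what the strong Følner boundary condition controls. -/
theorem hasLowerBeurlingDensity {Λ : Set G} (hΛ : Λ.Countable) :
    HasLowerBeurlingDensity μ Λ (lowerDensity μ Λ) := by
  intro K hK
  refine tendsto_order.2 ⟨fun b hb => ?_, fun a ha => Eventually.of_forall fun n => ha.trans_le' ?_⟩
  · simp only [lowerDensity, lt_iSup_iff] at hb
    obtain ⟨L, hL, hL0, hb⟩ := hb
    -- Adjoining `1` puts `K n` itself inside `K n * (L⁻¹ ∪ {1})`, so the part of `K n` removed by
    -- shrinking lies in the boundary set.
    have h1 := hK.tendsto_boundary (L⁻¹ ∪ {1}) (hL.inv.union isCompact_singleton)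
    have h2 : Tendsto (fun n => (1 - μ ((K n * (L⁻¹ ∪ {1})) ∩ ((K n)ᶜ * (L⁻¹ ∪ {1}))) / μ (K n)) *
        ⨅ x : G, ((Λ ∩ x • L).encard : ℝ≥0∞) / μ L) atTop
        (𝓝 ((1 - 0) * ⨅ x : G, ((Λ ∩ x • L).encard : ℝ≥0∞) / μ L)) :=
      ENNReal.Tendsto.mul_const (ENNReal.Tendsto.sub tendsto_const_nhds h1 (Or.inl (by simp)))
        (Or.inl (by simp))
    rw [tsub_zero, one_mul] at h2
    filter_upwards [h2.eventually_const_lt hb] with n hn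
    refine lt_of_lt_of_le hn (le_iInf fun x => ?_)
    have hKn0 := hK.measure_ne_zero n
    have hKnt := (hK.isCompact n).measure_ne_top (μ := μ)
    have hLt := hL.measure_ne_top (μ := μ)
    have h3 := mul_iInf_encard_inter_le μ hΛ (K n) hL x
    have h4 := measure_le_measure_interior_add_boundary μ (K n) L⁻¹
    rw [ENNReal.le_div_iff_mul_le (Or.inl hKn0) (Or.inl hKnt), mul_right_comm,
      ENNReal.sub_mul (fun _ _ => hKnt), one_mul, ENNReal.div_mul_cancel hKn0 hKnt]
    calc _ ≤ μ (K n \ ((K n)ᶜ * L⁻¹)) * ⨅ x : G, ((Λ ∩ x • L).encard : ℝ≥0∞) / μ L := by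
          gcongr
          exact tsub_le_iff_right.2 h4
      _ ≤ μ (K n \ ((K n)ᶜ * L⁻¹)) * ((⨅ x : G, ((Λ ∩ x • L).encard : ℝ≥0∞)) / μ L) := by
          gcongr
          rw [ENNReal.le_div_iff_mul_le (Or.inl hL0) (Or.inl hLt)]
          refine le_iInf fun x => ?_
          rw [← ENNReal.le_div_iff_mul_le (Or.inl hL0) (Or.inl hLt)]
          exact iInf_le (fun x : G => ((Λ ∩ x • L).encard : ℝ≥0∞) / μ L) x
      _ ≤ _ := by
          rw [← mul_div_assoc, ENNReal.div_le_iff hL0 hLt]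
          exact h3
  · exact le_iSup₂_of_le (K n) (hK.isCompact n)
      (le_iSup (fun _ : μ (K n) ≠ 0 => ⨅ x : G, ((Λ ∩ x • K n).encard : ℝ≥0∞) / μ (K n))
        (hK.measure_ne_zero n))

end Group

/-! ### Frames and their canonical duals. -/

section Frame

variable {ι H : Type*} [NormedAddCommGroup H] [InnerProductSpace ℂ H]

/-- Cauchy–Schwarz for the tail of a convergent series of products. -/
theorem norm_hasSum_sub_sum_le {a b : ι → ℂ} {s : ℂ} (hs : HasSum (fun i => a i * b i) s)
    (t : Finset ι) {α β : ℝ} (hα : 0 ≤ α) (hβ : 0 ≤ β)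
    (ha : ∀ v : Finset ι, ∑ i ∈ v, ‖a i‖ ^ 2 ≤ α ^ 2)
    (hb : ∀ v : Finset ι, Disjoint v t → ∑ i ∈ v, ‖b i‖ ^ 2 ≤ β ^ 2) :
    ‖s - ∑ i ∈ t, a i * b i‖ ≤ α * β := by
  classical
  have hlim : Tendsto (fun u : Finset ι => ‖∑ i ∈ u, a i * b i - ∑ i ∈ t, a i * b i‖) atTop
      (𝓝 ‖s - ∑ i ∈ t, a i * b i‖) := (hs.sub_const _).norm
  refine le_of_tendsto hlim ?_
  filter_upwards [eventually_ge_atTop t] with u hu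
  rw [← Finset.sum_sdiff hu, add_sub_cancel_right]
  have h1 : ‖∑ i ∈ u \ t, a i * b i‖ ≤ ∑ i ∈ u \ t, ‖a i‖ * ‖b i‖ :=
    (norm_sum_le _ _).trans_eq (by simp)
  refine h1.trans (abs_le_of_sq_le_sq' ?_ (mul_nonneg hα hβ)).2
  calc _ ≤ (∑ i ∈ u \ t, ‖a i‖ ^ 2) * ∑ i ∈ u \ t, ‖b i‖ ^ 2 :=
        Finset.sum_mul_sq_le_sq_mul_sq _ _ _
    _ ≤ α ^ 2 * β ^ 2 := by
        gcongr
        · exact ha _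
        · exact hb _ Finset.sdiff_disjoint
    _ = _ := by ring

/-- The analysis operator of a Bessel family. -/
theorem exists_analysisOperator {e : ι → H} {B : ℝ} (hB : 0 ≤ B)
    (hs : ∀ f : H, Summable (fun i => ‖inner ℂ (e i) f‖ ^ 2))
    (hle : ∀ f : H, ∑' i, ‖inner ℂ (e i) f‖ ^ 2 ≤ B * ‖f‖ ^ 2) :
    ∃ T : H →L[ℂ] lp (fun _ : ι => ℂ) 2, ∀ f i, T f i = inner ℂ (e i) f := by
  have hmem : ∀ f : H, Memℓp (fun i => (inner ℂ (e i) f : ℂ)) 2 := fun f =>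
    memℓp_gen (by simpa using hs f)
  let T₀ : H →ₗ[ℂ] lp (fun _ : ι => ℂ) 2 :=
    { toFun := fun f => ⟨fun i => inner ℂ (e i) f, hmem f⟩
      map_add' := fun f f' => by ext i; exact inner_add_right _ _ _
      map_smul' := fun c f => by ext i; exact inner_smul_right _ _ _ }
  refine ⟨T₀.mkContinuous (√B) fun f => ?_, fun f i => rfl⟩
  refine lp.norm_le_of_tsum_le (by simp) (by positivity) ?_
  have : (√B * ‖f‖) ^ 2 = B * ‖f‖ ^ 2 := by rw [mul_pow, Real.sq_sqrt hB]
  have h2 : ∀ i, (T₀ f : ι → ℂ) i = inner ℂ (e i) f := fun i => rfl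
  simpa [this, h2] using hle f

variable [CompleteSpace H]

/-- With `T` the analysis operator, `S = T*T`; each claim is the adjoint relation read off on the
unit vectors of `ℓ²`. -/
theorem exists_frameOperator {e : ι → H} {B : ℝ} (hB : 0 ≤ B)
    (hs : ∀ f : H, Summable (fun i => ‖inner ℂ (e i) f‖ ^ 2))
    (hle : ∀ f : H, ∑' i, ‖inner ℂ (e i) f‖ ^ 2 ≤ B * ‖f‖ ^ 2) :
    ∃ S : H →L[ℂ] H, (∀ f f', inner ℂ (S f) f' = inner ℂ f (S f')) ∧
      (∀ f, HasSum (fun i => (inner ℂ (e i) f : ℂ) • e i) (S f)) ∧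
      ∀ f, inner ℂ (S f) f = ((∑' i, ‖inner ℂ (e i) f‖ ^ 2 : ℝ) : ℂ) := by
  classical
  obtain ⟨T, hT⟩ := exists_analysisOperator hB hs hle
  refine ⟨T.adjoint ∘L T, fun f f' => ?_, fun f => ?_, fun f => ?_⟩
  · simp [ContinuousLinearMap.adjoint_inner_left, ContinuousLinearMap.adjoint_inner_right]
  · have h1 := (lp.hasSum_single (p := 2) (by simp) (T f)).mapL T.adjoint
    refine h1.congr_fun fun i => ?_
    refine ext_inner_right ℂ fun v => ?_
    rw [ContinuousLinearMap.adjoint_inner_left, lp.inner_single_left, hT, hT, inner_smul_left,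
      RCLike.inner_apply, mul_comm]
  · rw [ContinuousLinearMap.comp_apply, ContinuousLinearMap.adjoint_inner_left,
      lp.inner_eq_tsum, Complex.ofReal_tsum]
    refine tsum_congr fun i => ?_
    rw [hT, inner_self_eq_norm_sq_to_K]
    simp

/-- Bounds and reconstruction for a frame and its canonical dual. -/
theorem IsFrame.canonicalDual_spec {e : ι → H} (he : IsFrame e) :
    ∃ A B : ℝ, 0 < A ∧ 0 < B ∧
      (∀ f, A * ‖f‖ ^ 2 ≤ ∑' i, ‖inner ℂ (e i) f‖ ^ 2) ∧
      (∀ f, ∀ v : Finset ι, ∑ i ∈ v, ‖inner ℂ (e i) f‖ ^ 2 ≤ B * ‖f‖ ^ 2) ∧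
      (∀ f, ∀ v : Finset ι, ∑ i ∈ v, ‖inner ℂ (canonicalDual e i) f‖ ^ 2 ≤ A⁻¹ * ‖f‖ ^ 2) ∧
      (∀ f, HasSum (fun i => (inner ℂ (canonicalDual e i) f : ℂ) • e i) f) ∧
      ∀ i, ‖canonicalDual e i‖ ≤ A⁻¹ * ‖e i‖ := by
  obtain ⟨A, B, hA, hB, h⟩ := he
  obtain ⟨S, hsa, hsum, hquad⟩ := exists_frameOperator hB.le (fun f => (h f).1)
    (fun f => (h f).2.2)
  have hSe : frameOperator e = S := funext fun f => (hsum f).tsum_eq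
  have hlow : ∀ f, A * ‖f‖ ^ 2 ≤ ‖inner ℂ (S f) f‖ := fun f => by
    rw [hquad, Complex.norm_real]
    exact (h f).2.1.trans (le_abs_self _)
  have hbij : Function.Bijective S := by
    rw [← ContinuousLinearMap.isUnit_iff_bijective]
    refine ContinuousLinearMap.isUnit_of_forall_le_norm_inner_map S (c := ⟨A, hA.le⟩) hA fun f => ?_
    rw [mul_comm]
    exact hlow f
  have hdual : ∀ i, S (canonicalDual e i) = e i := fun i => by
    rw [← hSe]
    exact Function.invFun_eq (hSe ▸ hbij.2 (e i))
  -- Since `S` is onto, every vector is some `S w`, and this identity turns dual coefficients of `S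
  -- w` into frame coefficients of `w`.
  have hcoef : ∀ i w, inner ℂ (canonicalDual e i) (S w) = inner ℂ (e i) w := fun i w => by
    rw [← hsa, hdual]
  have hnorm : ∀ w, ‖w‖ ≤ A⁻¹ * ‖S w‖ := fun w => by
    rcases eq_or_ne w 0 with rfl | hw
    · simp
    have h1 := (hlow w).trans (norm_inner_le_norm (𝕜 := ℂ) _ _)
    rw [pow_two, ← mul_assoc] at h1
    have h2 := le_of_mul_le_mul_right h1 (norm_pos_iff.2 hw)
    rwa [inv_mul_eq_div, le_div_iff₀ hA, mul_comm]
  refine ⟨A, B, hA, hB, fun f => (h f).2.1, fun f v => ?_, fun f v => ?_, fun f => ?_, fun i => ?_⟩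
  · exact ((h f).1.sum_le_tsum v fun i _ => by positivity).trans (h f).2.2
  · obtain ⟨w, rfl⟩ := hbij.2 f
    simp only [hcoef]
    calc _ ≤ ∑' i, ‖inner ℂ (e i) w‖ ^ 2 := (h w).1.sum_le_tsum v fun i _ => by positivity
      _ ≤ ‖inner ℂ (S w) w‖ := by
        rw [hquad, Complex.norm_real]
        exact le_abs_self _
      _ ≤ ‖S w‖ * ‖w‖ := norm_inner_le_norm _ _
      _ ≤ ‖S w‖ * (A⁻¹ * ‖S w‖) := by gcongr; exact hnorm w
      _ = _ := by ring
  · obtain ⟨w, rfl⟩ := hbij.2 f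
    simp only [hcoef]
    exact hsum w
  · exact (hnorm _).trans_eq (by rw [hdual])

end Frame

/-! ### Projective representations: phases and continuity. -/

namespace ProjectiveRep

section Basic

variable {G H : Type*} [Group G] [MeasurableSpace G]
  [NormedAddCommGroup H] [InnerProductSpace ℂ H] (π : ProjectiveRep G H)

theorem exists_map_mul (x y : G) :
    ∃ c : ℂ, ‖c‖ = 1 ∧ ∀ f, π (x * y) f = c • π x (π y f) := by
  obtain ⟨σ, hσ⟩ := π.exists_cocycle
  exact ⟨σ (x, y), Circle.norm_coe _, hσ x y⟩

theorem exists_map_one : ∃ c : ℂ, ‖c‖ = 1 ∧ ∀ f, π 1 f = c • f := by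
  obtain ⟨c, hc, h⟩ := π.exists_map_mul 1 1
  have hc0 : c ≠ 0 := by rintro rfl; simp at hc
  refine ⟨c⁻¹, by simp [hc], fun f => ?_⟩
  have h1 : π 1 f = π 1 (c • π 1 f) := by
    rw [map_smul, ← h]
    simp
  rw [eq_inv_smul_iff₀ hc0]
  exact ((π 1).injective h1).symm

/-- `π(x)⁻¹ π(y)` is a unimodular multiple of `π(x⁻¹ y)`. -/
theorem exists_map_inv_mul (x y : G) :
    ∃ c : ℂ, ‖c‖ = 1 ∧ ∀ f, π y f = c • π x (π (x⁻¹ * y) f) := by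
  obtain ⟨c, hc, h⟩ := π.exists_map_mul x (x⁻¹ * y)
  refine ⟨c, hc, fun f => ?_⟩
  rw [← h, mul_inv_cancel_left]

theorem norm_inner_map_map (x y : G) (f g : H) :
    ‖inner ℂ (π x g) (π y f)‖ = ‖inner ℂ (π (y⁻¹ * x) g) f‖ := by
  obtain ⟨c, hc, h⟩ := π.exists_map_inv_mul y x
  rw [h, inner_smul_left, LinearIsometryEquiv.inner_map_map]
  simp [hc]

theorem norm_inner_map_inv (x : G) (f g : H) :
    ‖inner ℂ (π x⁻¹ g) f‖ = ‖inner ℂ (π x f) g‖ := by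
  obtain ⟨c, hc, h⟩ := π.exists_map_one
  have h1 := π.norm_inner_map_map 1 x f g
  rw [mul_one] at h1
  rw [← h1, h, inner_smul_left, norm_mul, RCLike.norm_conj, hc, one_mul, norm_inner_symm]

theorem stronglyMeasurable_inner (f g : H) : StronglyMeasurable fun x => inner ℂ (π x g) f :=
  (π.stronglyMeasurable g).inner stronglyMeasurable_const

end Basic

section Continuity

variable {G : Type*} [Group G] [TopologicalSpace G] [IsTopologicalGroup G] [T2Space G]
    [LocallyCompactSpace G] [SecondCountableTopology G] [MeasurableSpace G] [BorelSpace G]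
    {H : Type*} [NormedAddCommGroup H] [InnerProductSpace ℂ H] (π : ProjectiveRep G H)

/-- Measurable projective representations are projectively continuous at the identity. -/
theorem eventually_exists_norm_map_sub_smul_lt (μ : Measure G) [μ.IsHaarMeasure]
    [μ.IsMulRightInvariant] (u : H) {ε : ℝ} (hε : 0 < ε) :
    ∀ᶠ z in 𝓝 (1 : G), ∃ c : ℂ, ‖c‖ = 1 ∧ ‖π z u - c • u‖ < ε := by
  have := isInvInvariant_of_unimodular μ
  obtain ⟨D, hDc, hD⟩ := (π.stronglyMeasurable u).isSeparable_range
  let E : H → Set G := fun v => {x | ‖π x u - v‖ < ε / 2}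
  have hEm : ∀ v, MeasurableSet (E v) := fun v =>
    measurableSet_lt (((π.stronglyMeasurable u).sub stronglyMeasurable_const).norm.measurable)
      measurable_const
  have hcover : ⋃ v ∈ D, E v = Set.univ := by
    refine Set.eq_univ_of_forall fun x => ?_
    obtain ⟨v, hv, hd⟩ := Metric.mem_closure_iff.1 (hD ⟨x, rfl⟩) (ε / 2) (by positivity)
    exact Set.mem_biUnion hv (by simpa [E, dist_eq_norm] using hd)
  obtain ⟨v, -, hv⟩ : ∃ v ∈ D, μ (E v) ≠ 0 := by
    by_contra! h
    have h0 := (measure_biUnion_null_iff hDc).2 h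
    rw [hcover] at h0
    exact NeZero.ne (μ Set.univ) h0
  -- Steinhaus: the quotients of a set of positive measure fill a neighbourhood of `1`. Using the
  -- inverse of `E v` yields quotients `x⁻¹ * y` with `x, y ∈ E v`, the form in which `π(x)⁻¹π(y)`
  -- appears.
  have hS := Measure.div_mem_nhds_one_of_haar_pos μ (E v)⁻¹ (hEm v).inv
    (by rw [Measure.measure_inv]; exact pos_iff_ne_zero.2 hv)
  filter_upwards [hS] with z hz
  obtain ⟨x', hx, y', hy, rfl⟩ := hz
  obtain ⟨x, rfl⟩ := inv_surjective x'
  obtain ⟨y, rfl⟩ := inv_surjective y'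
  rw [Set.mem_inv, inv_inv] at hx hy
  obtain ⟨c, hc, h⟩ := π.exists_map_inv_mul x y
  have hc0 : c ≠ 0 := by rintro rfl; simp at hc
  refine ⟨c⁻¹, by simp [hc], ?_⟩
  have h1 : ‖π y u - π x u‖ < ε := by
    have hx : ‖π x u - v‖ < ε / 2 := hx
    have hy : ‖π y u - v‖ < ε / 2 := hy
    calc ‖π y u - π x u‖ = ‖(π y u - v) - (π x u - v)‖ := by congr 1; abel
      _ ≤ _ := norm_sub_le _ _
      _ < ε := by linarith
  have h2 : π y u - π x u = c • π x (π (x⁻¹ * y) u - c⁻¹ • u) := by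
    rw [map_sub, smul_sub, ← h, map_smul, smul_smul, mul_inv_cancel₀ hc0, one_smul]
  rw [h2, norm_smul, hc, one_mul, LinearIsometryEquiv.norm_map] at h1
  simpa [div_eq_mul_inv] using h1

/-- Only the modulus is continuous: the cocycle is arbitrary, so phases may jump. Continuity gives
point values of `V_g g` a meaning for sampling and makes the formal degree positive. -/
theorem continuous_norm_inner (μ : Measure G) [μ.IsHaarMeasure] [μ.IsMulRightInvariant]
    (f u : H) : Continuous fun x => ‖inner ℂ (π x u) f‖ := by
  refine continuous_iff_continuousAt.2 fun x₀ => Metric.tendsto_nhds.2 fun ε hε => ?_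
  have h1 := π.eventually_exists_norm_map_sub_smul_lt μ u (ε := ε / (‖f‖ + 1)) (by positivity)
  have h2 : Tendsto (fun x => x₀⁻¹ * x) (𝓝 x₀) (𝓝 1) := by
    have : Continuous fun x => x₀⁻¹ * x := by fun_prop
    simpa using this.tendsto x₀
  filter_upwards [h2.eventually h1] with x ⟨c, hc, hx⟩
  obtain ⟨c', hc', h⟩ := π.exists_map_inv_mul x₀ x
  have h3 : ‖inner ℂ (π x₀ u) f‖ = ‖inner ℂ (c' • π x₀ (c • u)) f‖ := by
    rw [map_smul, inner_smul_left, inner_smul_left]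
    simp [hc, hc']
  rw [h3, h, Real.dist_eq]
  calc _ ≤ ‖inner ℂ (c' • π x₀ (π (x₀⁻¹ * x) u)) f - inner ℂ (c' • π x₀ (c • u)) f‖ :=
        abs_norm_sub_norm_le _ _
    _ = ‖inner ℂ (c' • π x₀ (π (x₀⁻¹ * x) u - c • u)) f‖ := by
        rw [← inner_sub_left, ← smul_sub, ← map_sub]
    _ ≤ ‖c' • π x₀ (π (x₀⁻¹ * x) u - c • u)‖ * ‖f‖ := norm_inner_le_norm _ _
    _ = ‖π (x₀⁻¹ * x) u - c • u‖ * ‖f‖ := by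
        rw [norm_smul, hc', one_mul, LinearIsometryEquiv.norm_map]
    _ ≤ ε / (‖f‖ + 1) * ‖f‖ := by gcongr
    _ < ε := by
        rw [div_mul_eq_mul_div, div_lt_iff₀ (by positivity)]
        nlinarith [norm_nonneg f]

end Continuity

end ProjectiveRep

/-- A sesquilinear form on a complex space that vanishes on the diagonal vanishes. -/
theorem sesquilinear_eq_zero {E : Type*} [AddCommGroup E] [Module ℂ E]
    (Δ : E →ₗ⋆[ℂ] E →ₗ[ℂ] ℂ) (h : ∀ a, Δ a a = 0) (a b : E) : Δ a b = 0 := by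
  have h1 := h (a + b)
  have h2 := h (a + Complex.I • b)
  simp only [map_add, LinearMap.add_apply, h, map_smulₛₗ, LinearMap.smul_apply, RingHom.id_apply,
    smul_eq_mul, Complex.conj_I, mul_zero, zero_add, add_zero] at h1 h2
  have h3 : Complex.I * (2 * Δ a b) = 0 := by linear_combination h2 + Complex.I * h1
  simpa using h3

theorem inner_self_eq_ofReal {E : Type*} [NormedAddCommGroup E] [InnerProductSpace ℂ E] (v : E) :
    inner ℂ v v = ((‖v‖ ^ 2 : ℝ) : ℂ) := by
  rw [inner_self_eq_norm_sq_to_K]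
  simp

/-! ### Schur's lemma, orthogonality relations and the formal degree. -/

namespace ProjectiveRep

section Schur

variable {G H : Type*} [Group G] [MeasurableSpace G]
  [NormedAddCommGroup H] [InnerProductSpace ℂ H] [CompleteSpace H] {π : ProjectiveRep G H}

/-- Schur's lemma for bounded self-adjoint intertwiners. -/
theorem IsIrreducible.exists_eq_smul [Nontrivial H] (hπ : π.IsIrreducible) {T : H →L[ℂ] H}
    (hT : IsSelfAdjoint T) (hcomm : ∀ x f, T (π x f) = π x (T f)) :
    ∃ r : ℝ, ∀ f, T f = (r : ℂ) • f := by
  obtain ⟨r, hr⟩ := ContinuousFunctionalCalculus.spectrum_nonempty (R := ℝ) T hT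
  refine ⟨r, fun f => ?_⟩
  suffices hs : spectrum ℝ T ⊆ {r} by
    have h := CFC.eq_algebraMap_of_spectrum_subset_singleton T r hs hT
    rw [h]
    rfl
  intro s hs
  by_contra hne
  have hδ : 0 < |r - s| / 2 := by
    have : r - s ≠ 0 := sub_ne_zero.2 fun h => hne h.symm
    positivity
  set δ := |r - s| / 2 with hδdef
  -- Tent functions at two distinct spectral points. The half-distance `δ` makes their product
  -- vanish, so the kernel of one operator is a closed invariant subspace containing the range of
  -- the other. It is then neither `⊥` nor `⊤`.
  let p : ℝ → ℝ → ℝ := fun c t => max 0 (δ - |t - c|)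
  have hpc : ∀ c, Continuous (p c) := fun c => by fun_prop
  have hne0 : ∀ c ∈ spectrum ℝ T, cfc (p c) T ≠ 0 := by
    intro c hc h0
    have h1 := cfc_map_spectrum (p c) T hT (hpc c).continuousOn
    rw [h0, spectrum.zero_eq] at h1
    have h2 : p c c ∈ ({0} : Set ℝ) := h1 ▸ ⟨c, hc, rfl⟩
    have h3 : p c c = δ := by simp [p, hδ.le]
    rw [h3] at h2
    exact hδ.ne' h2
  have hmul : cfc (p r) T * cfc (p s) T = 0 := by
    rw [← cfc_mul (p r) (p s) T (hpc r).continuousOn (hpc s).continuousOn]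
    have : (fun t => p r t * p s t) = fun _ => 0 := by
      funext t
      rcases le_total δ |t - r| with h | h
      · simp [p, max_eq_left (sub_nonpos.2 h)]
      · have h' : δ ≤ |t - s| := by
          have := abs_sub_le r t s
          rw [abs_sub_comm r t] at this
          linarith
        simp [p, max_eq_left (sub_nonpos.2 h')]
    rw [this, cfc_const_zero]
  have hinv : ∀ x, ∀ f ∈ LinearMap.ker (cfc (p r) T).toLinearMap,
      π x f ∈ LinearMap.ker (cfc (p r) T).toLinearMap := by
    intro x f hf
    have hcomm' : Commute T ((π x).toContinuousLinearEquiv : H →L[ℂ] H) :=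
      ContinuousLinearMap.ext fun f => hcomm x f
    have h1 := congrArg (fun S : H →L[ℂ] H => S f) (hcomm'.cfc_real (p r)).eq
    have h2 : cfc (p r) T (π x f) = π x (cfc (p r) T f) := h1
    have h3 : cfc (p r) T f = 0 := hf
    change cfc (p r) T (π x f) = 0
    rw [h2, h3, map_zero]
  rcases hπ (LinearMap.ker (cfc (p r) T).toLinearMap) (cfc (p r) T).isClosed_ker hinv with h | h
  · refine hne0 s hs (ContinuousLinearMap.ext fun f => ?_)
    have h1 : cfc (p s) T f ∈ LinearMap.ker (cfc (p r) T).toLinearMap :=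
      congrArg (fun S : H →L[ℂ] H => S f) hmul
    rw [h] at h1
    simpa using h1
  · refine hne0 r hr (ContinuousLinearMap.ext fun f => ?_)
    have h1 : f ∈ LinearMap.ker (cfc (p r) T).toLinearMap := by rw [h]; trivial
    simpa using h1

/-- An injective bounded map into an irreducible representation that intertwines it with unitaries
is a multiple of a unitary. -/
theorem IsIrreducible.exists_norm_sq_eq (hπ : π.IsIrreducible) {E : Type*}
    [NormedAddCommGroup E] [InnerProductSpace ℂ E] [CompleteSpace E] (J : E →L[ℂ] H)
    (hinj : Function.Injective J) {w₀ : E} (hw₀ : w₀ ≠ 0)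
    (hU : ∀ x : G, ∃ U : E → E, Function.Surjective U ∧ (∀ w, J (U w) = π x (J w)) ∧
      ∀ w v, inner ℂ (U w) (U v) = inner ℂ w v) :
    ∃ r : ℝ, r ≠ 0 ∧ ∀ f, ∃ w, J w = f ∧ ‖f‖ ^ 2 = r * ‖w‖ ^ 2 := by
  have hJw₀ : J w₀ ≠ 0 := fun h => hw₀ (hinj (by rw [h, map_zero]))
  have : Nontrivial H := nontrivial_of_ne _ 0 hJw₀
  have hsa : IsSelfAdjoint (J ∘L J.adjoint) := by
    rw [ContinuousLinearMap.isSelfAdjoint_iff', ContinuousLinearMap.adjoint_comp,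
      ContinuousLinearMap.adjoint_adjoint]
  obtain ⟨r, hr⟩ := hπ.exists_eq_smul hsa fun x h => by
    obtain ⟨U, hUs, hUJ, hUi⟩ := hU x
    have key : J.adjoint (π x h) = U (J.adjoint h) := by
      refine ext_inner_right ℂ fun v => ?_
      obtain ⟨v, rfl⟩ := hUs v
      rw [ContinuousLinearMap.adjoint_inner_left, hUJ, LinearIsometryEquiv.inner_map_map, hUi,
        ContinuousLinearMap.adjoint_inner_left]
    rw [ContinuousLinearMap.comp_apply, ContinuousLinearMap.comp_apply, key, hUJ]
  -- `J J* = r` becomes `J* J = r` by cancelling the injective `J`. The first identity makes `J`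
  -- onto once `r ≠ 0`; the second gives the norm relation.
  have hJJ : ∀ w, J.adjoint (J w) = (r : ℂ) • w := fun w => by
    refine hinj ?_
    have := hr (J w)
    rwa [ContinuousLinearMap.comp_apply, ← map_smul] at this
  have hnorm : ∀ w, ‖J w‖ ^ 2 = r * ‖w‖ ^ 2 := fun w => by
    have h1 : inner ℂ (J w) (J w) = (r : ℂ) * inner ℂ w w := by
      rw [← ContinuousLinearMap.adjoint_inner_left, hJJ, inner_smul_left, Complex.conj_ofReal]
    simp only [inner_self_eq_ofReal] at h1
    exact_mod_cast h1
  have hr0 : r ≠ 0 := by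
    rintro rfl
    have := hnorm w₀
    rw [zero_mul] at this
    exact hJw₀ (by simpa using this)
  refine ⟨r, hr0, fun f => ⟨(r : ℂ)⁻¹ • J.adjoint f, ?_⟩⟩
  have hf : J ((r : ℂ)⁻¹ • J.adjoint f) = f := by
    rw [map_smul, ← ContinuousLinearMap.comp_apply, hr, smul_smul,
      inv_mul_cancel₀ (by exact_mod_cast hr0), one_smul]
  exact ⟨hf, by rw [← hnorm, hf]⟩

end Schur

section Graph

variable {G H : Type*} [Group G] [MeasurableSpace G]
  [NormedAddCommGroup H] [InnerProductSpace ℂ H] (π : ProjectiveRep G H) (μ : Measure G)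

/-- The graph of the (densely defined) coefficient transform `f ↦ ⟨f, π(·) u⟩` with values in
`L²`. -/
noncomputable def coeffGraph (u : H) : Submodule ℂ (WithLp 2 (H × Lp ℂ 2 μ)) where
  carrier := {p | p.snd =ᵐ[μ] fun x => inner ℂ (π x u) p.fst}
  zero_mem' := by
    filter_upwards [Lp.coeFn_zero ℂ 2 μ] with x hx
    simpa using hx
  add_mem' := by
    intro p q hp hq
    filter_upwards [hp, hq, Lp.coeFn_add p.snd q.snd] with x h1 h2 h3
    rw [WithLp.add_snd, WithLp.add_fst, h3, Pi.add_apply, h1, h2, inner_add_right]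
  smul_mem' := by
    intro c p hp
    filter_upwards [hp, Lp.coeFn_smul c p.snd] with x h1 h3
    rw [WithLp.smul_snd, WithLp.smul_fst, h3, Pi.smul_apply, h1, inner_smul_right, smul_eq_mul]

/-- An `L²` limit is an a.e. limit along a subsequence, while the coefficients converge pointwise.
Closedness makes the graph a Hilbert space, so its projection to `H` has an adjoint even though the
transform is not yet known to be defined everywhere. -/
theorem isClosed_coeffGraph (u : H) :
    IsClosed (π.coeffGraph μ u : Set (WithLp 2 (H × Lp ℂ 2 μ))) := by
  refine IsSeqClosed.isClosed fun p q hp hpq => ?_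
  have h1 : Tendsto (fun n => (p n).fst) atTop (𝓝 q.fst) :=
    ((WithLp.fstL 2 ℂ H (Lp ℂ 2 μ)).continuous.tendsto q).comp hpq
  have h2 : Tendsto (fun n => (p n).snd) atTop (𝓝 q.snd) :=
    ((WithLp.sndL 2 ℂ H (Lp ℂ 2 μ)).continuous.tendsto q).comp hpq
  obtain ⟨ns, hns, hae⟩ := (tendstoInMeasure_of_tendsto_Lp h2).exists_seq_tendsto_ae
  have hp' : ∀ᵐ x ∂μ, ∀ n, (p n).snd x = inner ℂ (π x u) (p n).fst :=
    ae_all_iff.2 fun n => hp n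
  change _ =ᵐ[μ] _
  filter_upwards [hae, hp'] with x hx hx'
  refine tendsto_nhds_unique hx ?_
  simp only [hx']
  exact (tendsto_const_nhds.inner (h1.comp hns.tendsto_atTop))

variable {π μ}

theorem exists_mem_coeffGraph {u f : H} (hf : MemLp (fun x => inner ℂ (π x u) f) 2 μ) :
    ∃ w : π.coeffGraph μ u, w.1.fst = f :=
  ⟨⟨WithLp.toLp 2 (f, hf.toLp _), hf.coeFn_toLp⟩, rfl⟩

theorem memLp_of_mem_coeffGraph {u : H} (w : π.coeffGraph μ u) :
    MemLp (fun x => inner ℂ (π x u) w.1.fst) 2 μ :=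
  (memLp_congr_ae w.2).1 (Lp.memLp _)

theorem inner_coeffGraph {u : H} (w v : π.coeffGraph μ u) :
    inner ℂ w v = inner ℂ w.1.fst v.1.fst +
      ∫ x, inner ℂ (inner ℂ (π x u) w.1.fst : ℂ) (inner ℂ (π x u) v.1.fst : ℂ) ∂μ := by
  rw [Submodule.coe_inner, WithLp.prod_inner_apply, L2.inner_def]
  congr 1
  refine integral_congr_ae ?_
  filter_upwards [w.2, v.2] with x h1 h2
  exact congrArg₂ (inner ℂ) h1 h2

theorem eq_of_fst_eq {u : H} {w v : π.coeffGraph μ u} (h : w.1.fst = v.1.fst) : w = v := by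
  refine Subtype.ext ?_
  refine WithLp.ofLp_injective 2 (Prod.ext h (Lp.ext ?_))
  filter_upwards [w.2, v.2] with x h1 h2
  exact (h1.trans (by rw [h])).trans h2.symm

end Graph

section Translation

variable {G H : Type*} [Group G] [MeasurableSpace G]
  [NormedAddCommGroup H] [InnerProductSpace ℂ H] {π : ProjectiveRep G H} {μ : Measure G}

theorem integrable_inner_mul_inner {f₁ f₂ g₁ g₂ : H}
    (h₁ : MemLp (fun x => inner ℂ (π x g₁) f₁) 2 μ)
    (h₂ : MemLp (fun x => inner ℂ (π x g₂) f₂) 2 μ) :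
    Integrable (fun x => inner ℂ (π x g₁) f₁ * inner ℂ f₂ (π x g₂)) μ := by
  refine h₁.integrable_mul (h₂.congr_norm (g := fun x => inner ℂ f₂ (π x g₂)) ?_ ?_)
  · exact (stronglyMeasurable_const.inner (π.stronglyMeasurable g₂)).aestronglyMeasurable
  · exact Eventually.of_forall fun x => norm_inner_symm _ _

/-- Polarization of the isometry property to the full orthogonality relations. -/
theorem isFormalDegree_of_integral_norm_sq {C : ℝ} (hC : 0 < C)
    (h : ∀ g f, MemLp (fun x => inner ℂ (π x g) f) 2 μ ∧
      ∫ x, ‖inner ℂ (π x g) f‖ ^ 2 ∂μ = C * ‖g‖ ^ 2 * ‖f‖ ^ 2) :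
    π.IsFormalDegree μ C⁻¹ := by
  have hint : ∀ f₁ f₂ g₁ g₂ : H,
      Integrable (fun x => inner ℂ (π x g₁) f₁ * inner ℂ f₂ (π x g₂)) μ := fun f₁ f₂ g₁ g₂ =>
    integrable_inner_mul_inner (h g₁ f₁).1 (h g₂ f₂).1
  have hdiag : ∀ g f₁ f₂ : H, ∫ x, inner ℂ (π x g) f₁ * inner ℂ f₂ (π x g) ∂μ
      = (C : ℂ) * inner ℂ f₂ f₁ * inner ℂ g g := by
    intro g f₁ f₂
    let Δ : H →ₗ⋆[ℂ] H →ₗ[ℂ] ℂ := LinearMap.mk₂'ₛₗ (starRingEnd ℂ) (RingHom.id ℂ)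
      (fun f₂ f₁ => ∫ x, inner ℂ (π x g) f₁ * inner ℂ f₂ (π x g) ∂μ
        - (C : ℂ) * inner ℂ f₂ f₁ * inner ℂ g g)
      (fun a b c => by
        simp only [inner_add_left, mul_add]
        rw [integral_add (hint _ _ _ _) (hint _ _ _ _)]
        ring)
      (fun c a b => by
        simp only [inner_smul_left, mul_left_comm _ (conj c), integral_const_mul, smul_eq_mul]
        ring)
      (fun a b c => by
        simp only [inner_add_right, add_mul]
        rw [integral_add (hint _ _ _ _) (hint _ _ _ _)]
        ring)
      (fun c a b => by
        simp only [inner_smul_right, mul_assoc, integral_const_mul, smul_eq_mul, RingHom.id_apply]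
        ring)
    refine sub_eq_zero.1 (sesquilinear_eq_zero Δ (fun f => sub_eq_zero.2 ?_) f₂ f₁)
    have h1 : ∀ x, inner ℂ (π x g) f * inner ℂ f (π x g)
        = ((‖inner ℂ (π x g) f‖ ^ 2 : ℝ) : ℂ) := fun x => by
      rw [← inner_conj_symm f, Complex.mul_conj']
      simp
    simp only [h1, integral_complex_ofReal, (h g f).2, inner_self_eq_ofReal]
    push_cast
    ring
  refine ⟨inv_pos.2 hC, fun f₁ f₂ g₁ g₂ => ⟨hint _ _ _ _, ?_⟩⟩
  rw [inner_conj_symm, Complex.ofReal_inv, inv_inv]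
  let Δ : H →ₗ⋆[ℂ] H →ₗ[ℂ] ℂ := LinearMap.mk₂'ₛₗ (starRingEnd ℂ) (RingHom.id ℂ)
    (fun g₁ g₂ => ∫ x, inner ℂ (π x g₁) f₁ * inner ℂ f₂ (π x g₂) ∂μ
      - (C : ℂ) * inner ℂ f₂ f₁ * inner ℂ g₁ g₂)
    (fun a b c => by
      simp only [map_add, inner_add_left, add_mul]
      rw [integral_add (hint _ _ _ _) (hint _ _ _ _)]
      ring)
    (fun c a b => by
      simp only [map_smul, inner_smul_left, mul_assoc, integral_const_mul, smul_eq_mul]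
      ring)
    (fun a b c => by
      simp only [map_add, inner_add_right, mul_add]
      rw [integral_add (hint _ _ _ _) (hint _ _ _ _)]
      ring)
    (fun c a b => by
      simp only [map_smul, inner_smul_right, mul_left_comm, integral_const_mul, smul_eq_mul,
        RingHom.id_apply]
      ring)
  exact sub_eq_zero.1 (sesquilinear_eq_zero Δ (fun g => sub_eq_zero.2 (hdiag g f₁ f₂)) g₁ g₂)

theorem memLp_inner_inv [MeasurableInv G] [μ.IsInvInvariant] {u f : H}
    (hf : MemLp (fun x => inner ℂ (π x u) f) 2 μ) : MemLp (fun x => inner ℂ (π x f) u) 2 μ :=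
  (hf.comp_measurePreserving (Measure.measurePreserving_inv μ)).congr_norm
    (π.stronglyMeasurable_inner _ _).aestronglyMeasurable
    (Eventually.of_forall fun x => π.norm_inner_map_inv x f u)

theorem integral_norm_inner_comm [MeasurableInv G] [μ.IsInvInvariant] (u f : H) :
    ∫ x, ‖inner ℂ (π x u) f‖ ^ 2 ∂μ = ∫ x, ‖inner ℂ (π x f) u‖ ^ 2 ∂μ := by
  rw [← integral_inv_eq_self]
  simp only [π.norm_inner_map_inv]

variable [MeasurableMul G] [μ.IsMulLeftInvariant]

theorem memLp_inner_map {u f : H} (hf : MemLp (fun x => inner ℂ (π x u) f) 2 μ) (x : G) :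
    MemLp (fun y => inner ℂ (π y u) (π x f)) 2 μ := by
  refine (hf.comp_measurePreserving (measurePreserving_mul_left μ x⁻¹)).congr_norm
    (π.stronglyMeasurable_inner _ _).aestronglyMeasurable (Eventually.of_forall fun y => ?_)
  exact (π.norm_inner_map_map y x f u).symm

theorem memLp_inner_symm {u f : H} (hf : MemLp (fun x => inner ℂ (π x u) f) 2 μ) (x : G) :
    MemLp (fun y => inner ℂ (π y u) ((π x).symm f)) 2 μ := by
  refine (hf.comp_measurePreserving (measurePreserving_mul_left μ x)).congr_norm
    (π.stronglyMeasurable_inner _ _).aestronglyMeasurable (Eventually.of_forall fun y => ?_)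
  have h := π.norm_inner_map_map (x * y) x ((π x).symm f) u
  simpa using h

/-- Left translation, with the phase from the cocycle cancelling against its conjugate. This makes
the action of `π` on the coefficient graph preserve inner products. -/
theorem integral_inner_map_map (u f f' : H) (x : G) :
    ∫ y, inner ℂ (inner ℂ (π y u) (π x f) : ℂ) (inner ℂ (π y u) (π x f') : ℂ) ∂μ
      = ∫ y, inner ℂ (inner ℂ (π y u) f : ℂ) (inner ℂ (π y u) f' : ℂ) ∂μ := by
  rw [← integral_mul_left_eq_self
    (fun y => inner ℂ (inner ℂ (π y u) f : ℂ) (inner ℂ (π y u) f' : ℂ)) x⁻¹]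
  congr 1
  funext y
  obtain ⟨c, hc, h⟩ := π.exists_map_inv_mul x y
  have hcc : c * conj c = 1 := by rw [Complex.mul_conj']; simp [hc]
  simp only [h u, inner_smul_left, LinearIsometryEquiv.inner_map_map, RCLike.inner_apply, map_mul,
    RCLike.conj_conj]
  linear_combination (inner ℂ (π (x⁻¹ * y) u) f' * conj (inner ℂ (π (x⁻¹ * y) u) f)) * hcc

end Translation

section Degree

variable {G H : Type*} [Group G] [MeasurableSpace G] [MeasurableMul G]
  [NormedAddCommGroup H] [InnerProductSpace ℂ H] [CompleteSpace H] {π : ProjectiveRep G H}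
  {μ : Measure G} [μ.IsMulLeftInvariant]

/-- If the coefficient transform of an irreducible representation is square-integrable for one
nonzero vector, then it is a multiple of an isometry. -/
theorem IsIrreducible.exists_integral_norm_inner_sq (hπ : π.IsIrreducible) {u f₀ : H}
    (hf₀ : f₀ ≠ 0) (hmem : MemLp (fun x => inner ℂ (π x u) f₀) 2 μ) :
    ∃ C : ℝ, ∀ f, MemLp (fun x => inner ℂ (π x u) f) 2 μ ∧
      ∫ x, ‖inner ℂ (π x u) f‖ ^ 2 ∂μ = C * ‖f‖ ^ 2 := by
  have hcl := π.isClosed_coeffGraph μ u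
  have : CompleteSpace (π.coeffGraph μ u) := hcl.completeSpace_coe
  let J : π.coeffGraph μ u →L[ℂ] H :=
    (WithLp.fstL 2 ℂ H (Lp ℂ 2 μ)).comp (π.coeffGraph μ u).subtypeL
  have hJ : ∀ w, J w = w.1.fst := fun w => rfl
  obtain ⟨w₀, hw₀⟩ := exists_mem_coeffGraph hmem
  obtain ⟨r, hr0, hr⟩ := hπ.exists_norm_sq_eq J (fun w v h => eq_of_fst_eq h) (w₀ := w₀)
    (by rintro rfl; exact hf₀ hw₀.symm) (fun x => by
      choose U hU using fun w : π.coeffGraph μ u =>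
        exists_mem_coeffGraph (memLp_inner_map (memLp_of_mem_coeffGraph w) x)
      refine ⟨U, fun v => ?_, hU, fun w v => ?_⟩
      · obtain ⟨v₀, hv₀⟩ := exists_mem_coeffGraph (memLp_inner_symm (memLp_of_mem_coeffGraph v) x)
        refine ⟨v₀, eq_of_fst_eq ?_⟩
        rw [hU, hv₀, LinearIsometryEquiv.apply_symm_apply]
      · rw [inner_coeffGraph, hU, hU, integral_inner_map_map, LinearIsometryEquiv.inner_map_map,
          ← inner_coeffGraph])
  -- The graph norm is `‖f‖² + ∫|⟨f, π(x)u⟩|²`, and Schur gives `‖f‖² = r ·` (graph norm); solve for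
  -- the integral.
  refine ⟨r⁻¹ - 1, fun f => ?_⟩
  obtain ⟨w, hw, hn⟩ := hr f
  have h1 : inner ℂ w w = _ := inner_coeffGraph w w
  have h2 : MemLp (fun x => inner ℂ (π x u) w.1.fst) 2 μ := memLp_of_mem_coeffGraph w
  rw [hJ] at hw
  rw [hw] at h1 h2
  refine ⟨h2, ?_⟩
  have h3 : ‖w‖ ^ 2 = ‖f‖ ^ 2 + ∫ x, ‖inner ℂ (π x u) f‖ ^ 2 ∂μ := by
    simp only [inner_self_eq_ofReal, integral_complex_ofReal] at h1
    exact_mod_cast h1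
  rw [h3] at hn
  field_simp
  linarith

end Degree

section FormalDegree

variable {G : Type*} [Group G] [TopologicalSpace G] [IsTopologicalGroup G] [T2Space G]
    [LocallyCompactSpace G] [SecondCountableTopology G] [MeasurableSpace G] [BorelSpace G]
    {μ : Measure G} [μ.IsHaarMeasure] [μ.IsMulRightInvariant]
    {H : Type*} [NormedAddCommGroup H] [InnerProductSpace ℂ H] [CompleteSpace H]
    {π : ProjectiveRep G H}

/-- A discrete series representation of a unimodular group has a formal degree. -/
theorem IsDiscreteSeries.exists_isFormalDegree (hπ : π.IsDiscreteSeries μ) :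
    ∃ d : ℝ, π.IsFormalDegree μ d := by
  have := isInvInvariant_of_unimodular μ
  obtain ⟨hirr, u, hu, hfin⟩ := hπ
  have hmem : MemLp (fun x => inner ℂ (π x u) u) 2 μ := by
    refine ⟨(π.stronglyMeasurable_inner _ _).aestronglyMeasurable, ?_⟩
    refine (eLpNorm_lt_top_iff_lintegral_rpow_enorm_lt_top (by simp) (by simp)).2 ?_
    simpa [coeff] using hfin
  obtain ⟨C, hC⟩ := hirr.exists_integral_norm_inner_sq hu hmem
  have hu' : 0 < ‖u‖ ^ 2 := by positivity
  have hall : ∀ g f, MemLp (fun x => inner ℂ (π x g) f) 2 μ ∧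
      ∫ x, ‖inner ℂ (π x g) f‖ ^ 2 ∂μ = C / ‖u‖ ^ 2 * ‖g‖ ^ 2 * ‖f‖ ^ 2 := by
    intro g f
    -- Inversion exchanges the two vectors in the squared integral. So `g` is admissible as a
    -- window, and evaluating at `f = u` in both ways gives `Cg‖u‖² = C‖g‖²`.
    obtain ⟨Cg, hCg⟩ := hirr.exists_integral_norm_inner_sq hu (memLp_inner_inv (hC g).1)
    refine ⟨(hCg f).1, ?_⟩
    have h1 := (hCg u).2
    rw [integral_norm_inner_comm, (hC g).2] at h1
    rw [(hCg f).2, div_mul_eq_mul_div, h1, mul_div_cancel_right₀ _ hu'.ne']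
  refine ⟨_, isFormalDegree_of_integral_norm_sq (C := C / ‖u‖ ^ 2) ?_ hall⟩
  have hpos : 0 < ∫ x, ‖inner ℂ (π x u) u‖ ^ 2 ∂μ := by
    refine integral_pos_of_integrable_nonneg_nonzero (x := 1)
      ((π.continuous_norm_inner μ u u).pow 2) ((memLp_two_iff_integrable_sq_norm hmem.1).1 hmem)
      (fun x => by positivity) ?_
    obtain ⟨c, hc, h1⟩ := π.exists_map_one
    have hc0 : c ≠ 0 := by rintro rfl; simp at hc
    simp [h1, hc0, hu]
  rw [(hC u).2] at hpos
  exact div_pos (pos_of_mul_pos_left hpos hu'.le) hu'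

end FormalDegree

end ProjectiveRep

/-! ### Separation of `Λ` and uniform decay of sampled coefficients. -/

theorem encard_le_of_forall_finset {α : Type*} {s : Set α} {N : ℕ}
    (h : ∀ v : Finset α, (v : Set α) ⊆ s → v.card ≤ N) : s.encard ≤ N := by
  by_contra hlt
  rw [not_le] at hlt
  obtain ⟨t, hts, ht⟩ := Set.exists_subset_encard_eq (Order.add_one_le_of_lt hlt)
  have hfin : t.Finite := Set.finite_of_encard_eq_coe (k := N + 1) (by rw [ht]; rfl)
  have h1 := h hfin.toFinset (by simpa using hts)
  rw [hfin.encard_eq_coe_toFinset_card] at ht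
  have h2 : hfin.toFinset.card = N + 1 := by exact_mod_cast ht
  omega

/-- Tightness of integrable functions on a σ-compact space. -/
theorem exists_isCompact_setLIntegral_compl_lt {X : Type*} [TopologicalSpace X] [T2Space X]
    [SigmaCompactSpace X] [MeasurableSpace X] [BorelSpace X] {μ : Measure X} {h : X → ℝ≥0∞}
    (hfin : ∫⁻ x, h x ∂μ ≠ ∞) {ε : ℝ≥0∞} (hε : 0 < ε) :
    ∃ E : Set X, IsCompact E ∧ ∫⁻ x in Eᶜ, h x ∂μ < ε := by
  have hm : ∀ n, MeasurableSet (compactCovering X n)ᶜ := fun n =>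
    (isCompact_compactCovering X n).measurableSet.compl
  have hlim : Tendsto (fun n => μ.withDensity h (compactCovering X n)ᶜ) atTop
      (𝓝 (μ.withDensity h (⋂ n, (compactCovering X n)ᶜ))) := by
    refine tendsto_measure_iInter_atTop (fun n => (hm n).nullMeasurableSet)
      (fun m n hmn => Set.compl_subset_compl.2 (compactCovering_subset X hmn)) ⟨0, ?_⟩
    rw [withDensity_apply _ (hm 0)]
    exact ((setLIntegral_le_lintegral _ _).trans_lt (lt_top_iff_ne_top.2 hfin)).ne
  rw [← Set.compl_iUnion, iUnion_compactCovering, Set.compl_univ, measure_empty] at hlim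
  obtain ⟨n, hn⟩ := (hlim.eventually_lt_const hε).exists
  exact ⟨_, isCompact_compactCovering X n, by rwa [withDensity_apply _ (hm n)] at hn⟩

section Sampling

variable {G : Type*} [Group G] [TopologicalSpace G] [IsTopologicalGroup G] [T2Space G]
    [LocallyCompactSpace G] [SecondCountableTopology G] [MeasurableSpace G] [BorelSpace G]
    {μ : Measure G} [μ.IsHaarMeasure]

/-- The pointwise supremum of a continuous function over translates of the interior of `Q` is
dominated by the local maximal function. -/
theorem iSup_interior_le_localMaximal {G : Type*} [Group G] [TopologicalSpace G]
    [IsTopologicalGroup G] [MeasurableSpace G] [BorelSpace G] {μ : Measure G} [μ.IsHaarMeasure]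
    {F : G → ℂ} (hF : Continuous fun x => ‖F x‖) (Q : Set G)
    (x : G) : ⨆ q ∈ interior Q, ‖F (x * q)‖ₑ ≤ localMaximal μ Q F x := by
  refine iSup₂_le fun q hq => le_of_forall_lt fun c hc => ?_
  have hcont : Continuous fun z => ‖F (x * z)‖ₑ := by
    have : ∀ z, ‖F (x * z)‖ₑ = ENNReal.ofReal ‖F (x * z)‖ := fun z => (ofReal_norm _).symm
    simp only [this]
    exact ENNReal.continuous_ofReal.comp (hF.comp (continuous_const_mul x))
  obtain ⟨c', hcc', hc'⟩ := exists_between hc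
  refine hcc'.trans_le ?_
  by_contra hlt
  rw [not_le] at hlt
  have h1 := ae_lt_of_essSup_lt hlt
  have hO : IsOpen ({z | c' < ‖F (x * z)‖ₑ} ∩ interior Q) :=
    (isOpen_lt continuous_const hcont).inter isOpen_interior
  -- A nonempty open set has positive Haar measure, so an essential bound on `Q` holds at every
  -- point of its interior. Points of `Q` outside the interior could escape it.
  have h2 : 0 < μ ({z | c' < ‖F (x * z)‖ₑ} ∩ interior Q) := hO.measure_pos μ ⟨q, hc', hq⟩
  rw [ae_iff] at h1
  have h3 : μ.restrict Q ({z | c' < ‖F (x * z)‖ₑ} ∩ interior Q) = 0 :=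
    measure_mono_null (fun z hz => not_lt.2 (le_of_lt hz.1)) h1
  rw [Measure.restrict_apply hO.measurableSet, Set.inter_eq_left.2
    (Set.inter_subset_right.trans interior_subset)] at h3
  exact h2.ne' h3

/-- Uniform smallness of the sampled tails of a function with square-integrable local maximal
function. -/
theorem exists_isCompact_tail_le {F : G → ℂ} (hF : Continuous fun x => ‖F x‖) {Q : Set G}
    (hQn : Q ∈ 𝓝 (1 : G)) (hint : ∫⁻ x, localMaximal μ Q F x ^ (2 : ℝ) ∂μ < ∞)
    {Λ U : Set G} {N : ℕ} (hU : U ∈ 𝓝 (1 : G)) (hUc : IsCompact U)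
    (hN : ∀ x : G, (Λ ∩ x • U).encard ≤ N) {ε : ℝ} (hε : 0 < ε) :
    ∃ C : Set G, IsCompact C ∧ ∀ (y : G) (v : Finset Λ), (∀ l ∈ v, (l : G) ∉ y • C) →
      ∑ l ∈ v, ‖F (y⁻¹ * l)‖ ^ 2 ≤ ε := by
  classical
  set m : G → ℝ≥0∞ := fun x => (⨆ q ∈ interior Q, ‖F (x * q)‖ₑ) ^ (2 : ℝ) with hm
  have hmeas : Measurable m := by
    refine Measurable.pow_const (LowerSemicontinuous.measurable ?_) _
    refine lowerSemicontinuous_biSup fun q _ => Continuous.lowerSemicontinuous ?_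
    have : ∀ x, ‖F (x * q)‖ₑ = ENNReal.ofReal ‖F (x * q)‖ := fun z => (ofReal_norm _).symm
    simp only [this]
    exact ENNReal.continuous_ofReal.comp (hF.comp (continuous_mul_const q))
  have hmfin : ∫⁻ x, m x ∂μ ≠ ∞ := by
    refine ((lintegral_mono fun x => ?_).trans_lt hint).ne
    exact ENNReal.rpow_le_rpow (iSup_interior_le_localMaximal hF Q x) (by norm_num)
  set V : Set G := (interior Q)⁻¹ ∩ (interior U)⁻¹ with hV
  have hVo : IsOpen V := isOpen_interior.inv.inter isOpen_interior.inv
  have h1V : (1 : G) ∈ V := ⟨by simpa using mem_interior_iff_mem_nhds.2 hQn, by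
    simpa using mem_interior_iff_mem_nhds.2 hU⟩
  have hVinvQ : ∀ q ∈ V, q⁻¹ ∈ interior Q := fun q hq => hq.1
  have hVinvU : ∀ q ∈ V, q⁻¹ ∈ U := fun q hq => interior_subset hq.2
  have hVpos : 0 < μ V := hVo.measure_pos μ ⟨1, h1V⟩
  have hVfin : μ V ≠ ∞ := by
    refine (measure_mono_top (Set.inter_subset_right.trans ?_)).mt hUc.inv.measure_ne_top
    exact Set.inv_subset_inv.2 interior_subset
  -- The denominator `N + 1` avoids division by zero when `N = 0`.
  obtain ⟨E, hEc, hE⟩ := exists_isCompact_setLIntegral_compl_lt hmfin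
    (ε := μ V * ENNReal.ofReal ε / (N + 1)) (by
      refine ENNReal.div_pos (mul_ne_zero hVpos.ne' ?_) (by simp)
      simpa using hε)
  refine ⟨E * U, hEc.mul hUc, fun y v hv => ?_⟩
  -- Each sample `|F(y⁻¹l)|²` is spread over `w ∈ y⁻¹lV`, where `m w` dominates it. Overlaps number
  -- at most `N`, since `w` forces `l ∈ ywU`, and `l ∉ yEU` keeps `w` out of `E`. Integrating in `w`
  -- compares the sum with `∫_{Eᶜ} m`.
  have hpt : ∀ w, ∑ l ∈ v, ((y⁻¹ * (l : G)) • V).indicator (fun _ => ‖F (y⁻¹ * l)‖ₑ ^ (2 : ℝ)) w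
      ≤ N * Eᶜ.indicator m w := by
    intro w
    have hterm : ∀ l ∈ v,
        ((y⁻¹ * (l : G)) • V).indicator (fun _ => ‖F (y⁻¹ * l)‖ₑ ^ (2 : ℝ)) w
          ≤ if (l : G) ∈ (y * w) • U then Eᶜ.indicator m w else 0 := by
      intro l hl
      by_cases hw : w ∈ (y⁻¹ * (l : G)) • V
      · obtain ⟨q, hq, rfl⟩ := hw
        simp only [smul_eq_mul]
        have h1 : (l : G) ∈ (y * (y⁻¹ * (l : G) * q)) • U :=
          ⟨q⁻¹, hVinvU q hq, by simp [mul_assoc]⟩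
        have h2 : y⁻¹ * (l : G) * q ∈ Eᶜ := fun hmem => hv l hl
          ⟨y⁻¹ * l, ⟨_, hmem, q⁻¹, hVinvU q hq, by simp⟩, by simp⟩
        rw [if_pos h1, Set.indicator_of_mem h2,
          Set.indicator_of_mem (by exact ⟨q, hq, rfl⟩)]
        refine ENNReal.rpow_le_rpow ?_ (by norm_num)
        refine le_iSup₂_of_le q⁻¹ (hVinvQ q hq) (by simp)
      · rw [Set.indicator_of_notMem hw]
        exact zero_le
    refine (Finset.sum_le_sum hterm).trans ?_
    rw [← Finset.sum_filter, Finset.sum_const, nsmul_eq_mul]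
    gcongr
    have h3 : ((v.filter fun l : Λ => (l : G) ∈ (y * w) • U).card : ℕ∞) ≤ N := by
      refine le_trans ?_ (hN (y * w))
      rw [← Set.encard_coe_eq_coe_finsetCard, ← Subtype.val_injective.encard_image]
      refine Set.encard_le_encard ?_
      rintro _ ⟨l, hl, rfl⟩
      simp only [Finset.coe_filter, Set.mem_ofPred_eq] at hl
      exact ⟨l.2, hl.2⟩
    exact_mod_cast h3
  have hsum : (∑ l ∈ v, ‖F (y⁻¹ * l)‖ₑ ^ (2 : ℝ)) * μ V ≤ N * ∫⁻ x in Eᶜ, m x ∂μ := by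
    calc _ = ∫⁻ w, ∑ l ∈ v,
          ((y⁻¹ * (l : G)) • V).indicator (fun _ => ‖F (y⁻¹ * l)‖ₑ ^ (2 : ℝ)) w ∂μ := by
          rw [lintegral_finsetSum]
          · rw [Finset.sum_mul]
            refine Finset.sum_congr rfl fun l _ => ?_
            rw [lintegral_indicator_const (hVo.smul _).measurableSet, measure_smul]
          · exact fun l _ => measurable_const.indicator (hVo.smul _).measurableSet
      _ ≤ ∫⁻ w, N * Eᶜ.indicator m w ∂μ := lintegral_mono hpt
      _ = _ := by
          rw [lintegral_const_mul _ (hmeas.indicator hEc.measurableSet.compl),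
            lintegral_indicator hEc.measurableSet.compl]
  have hle : (∑ l ∈ v, ‖F (y⁻¹ * l)‖ₑ ^ (2 : ℝ)) * μ V ≤ ENNReal.ofReal ε * μ V := by
    refine hsum.trans ?_
    calc (N : ℝ≥0∞) * ∫⁻ x in Eᶜ, m x ∂μ
        ≤ (N + 1) * (μ V * ENNReal.ofReal ε / (N + 1)) := by
          gcongr
          exact le_self_add
      _ = ENNReal.ofReal ε * μ V := by
          rw [ENNReal.mul_div_cancel (by simp) (by finiteness), mul_comm]
  rw [ENNReal.mul_le_mul_iff_left hVpos.ne' hVfin] at hle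
  have heq : ∑ l ∈ v, ‖F (y⁻¹ * l)‖ₑ ^ (2 : ℝ)
      = ENNReal.ofReal (∑ l ∈ v, ‖F (y⁻¹ * l)‖ ^ 2) := by
    rw [ENNReal.ofReal_sum_of_nonneg fun _ _ => by positivity]
    refine Finset.sum_congr rfl fun l _ => ?_
    rw [ENNReal.ofReal_pow (norm_nonneg _), ofReal_norm]
    norm_cast
  rw [heq] at hle
  exact (ENNReal.ofReal_le_ofReal_iff hε.le).1 hle

variable {H : Type*} [NormedAddCommGroup H] [InnerProductSpace ℂ H] {π : ProjectiveRep G H}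

/-- The index set of a Bessel coherent system is relatively separated. -/
theorem exists_encard_inter_smul_le [μ.IsMulRightInvariant] {Λ : Set G} {g : H} (hg : g ≠ 0)
    {B : ℝ} (hB : ∀ f, ∀ v : Finset Λ, ∑ l ∈ v, ‖inner ℂ (π l g) f‖ ^ 2 ≤ B * ‖f‖ ^ 2) :
    ∃ U ∈ 𝓝 (1 : G), IsCompact U ∧ ∃ N : ℕ, ∀ x : G, (Λ ∩ x • U).encard ≤ N := by
  have hg' : 0 < ‖g‖ := norm_pos_iff.2 hg
  have h1 : ‖g‖ ^ 2 / 2 < ‖inner ℂ (π 1 g) g‖ := by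
    obtain ⟨c, hc, h1⟩ := π.exists_map_one
    rw [h1, inner_smul_left, norm_mul, RCLike.norm_conj, hc, one_mul, inner_self_eq_ofReal,
      Complex.norm_real, Real.norm_of_nonneg (by positivity)]
    exact half_lt_self (by positivity)
  obtain ⟨U, hUn, hUs, hUc⟩ := local_compact_nhds
    ((isOpen_lt continuous_const (π.continuous_norm_inner μ g g)).mem_nhds h1)
  -- Test the Bessel bound on `π(x)g`: each `l ∈ Λ ∩ xU` contributes at least `(‖g‖²/2)²` to a sum
  -- bounded by `B‖g‖²`.
  refine ⟨U, hUn, hUc, ⌊B * ‖g‖ ^ 2 / (‖g‖ ^ 2 / 2) ^ 2⌋₊, fun x => ?_⟩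
  rw [← Subtype.image_preimage_coe, Subtype.val_injective.encard_image]
  refine encard_le_of_forall_finset fun v hv => Nat.le_floor ?_
  rw [le_div_iff₀ (by positivity)]
  refine le_trans ?_ ((hB (π x g) v).trans_eq (by rw [LinearIsometryEquiv.norm_map]))
  rw [← nsmul_eq_mul]
  refine Finset.card_nsmul_le_sum _ _ _ fun l hl => ?_
  rw [π.norm_inner_map_map]
  have h2 : (l : G) ∈ x • U := hv hl
  rw [Set.mem_smul_set_iff_inv_smul_mem] at h2
  have h3 : ‖g‖ ^ 2 / 2 < ‖inner ℂ (π (x⁻¹ * l) g) g‖ := hUs h2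
  gcongr

theorem upperDensity_lt_top {G : Type*} [Group G] [TopologicalSpace G] [MeasurableSpace G]
    {μ : Measure G} [μ.IsHaarMeasure] {Λ U : Set G} (hU : U ∈ 𝓝 (1 : G)) (hUc : IsCompact U) {N : ℕ}
    (hN : ∀ x : G, (Λ ∩ x • U).encard ≤ N) : upperDensity μ Λ < ∞ := by
  have hU0 : μ U ≠ 0 := (Measure.measure_pos_of_mem_nhds μ hU).ne'
  refine lt_of_le_of_lt (b := (N : ℝ≥0∞) / μ U) ?_ (ENNReal.div_lt_top (by simp) hU0)
  refine iInf₂_le_of_le U hUc (iInf_le_of_le hU0 (iSup_le fun x => ?_))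
  gcongr
  exact_mod_cast hN x

/-- A set that meets every translate of a compact set has positive lower density. -/
theorem lowerDensity_pos {G : Type*} [Group G] [TopologicalSpace G] [LocallyCompactSpace G]
    [MeasurableSpace G] {μ : Measure G} [μ.IsHaarMeasure] {Λ C : Set G} (hC : IsCompact C)
    (h : ∀ y : G, (Λ ∩ y • C).Nonempty) : 0 < lowerDensity μ Λ := by
  obtain ⟨U, hUc, hU⟩ := exists_compact_mem_nhds (1 : G)
  have h0 : μ (C ∪ U) ≠ 0 :=
    ((Measure.measure_pos_of_mem_nhds μ hU).trans_le (measure_mono Set.subset_union_right)).ne'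
  refine lt_of_lt_of_le (b := 1 / μ (C ∪ U))
    (ENNReal.div_pos one_ne_zero (hC.union hUc).measure_ne_top) ?_
  refine le_iSup₂_of_le (C ∪ U) (hC.union hUc) (le_iSup_of_le h0 (le_iInf fun y => ?_))
  gcongr
  have h1 : (Λ ∩ y • (C ∪ U)).Nonempty :=
    (h y).mono (Set.inter_subset_inter_right _ (Set.smul_set_mono Set.subset_union_left))
  exact_mod_cast Set.one_le_encard_iff_nonempty.2 h1

end Sampling

/-! ### The localized trace estimate. -/

theorem norm_setIntegral_mul_le {X : Type*} [MeasurableSpace X] {μ : Measure X} {a b : X → ℂ}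
    (ha : MemLp a 2 μ) (hb : MemLp b 2 μ) {s : Set X} {α β : ℝ} (hα : 0 ≤ α) (hβ : 0 ≤ β)
    (haα : ∫ x, ‖a x‖ ^ 2 ∂μ ≤ α ^ 2) (hbβ : ∫ x in s, ‖b x‖ ^ 2 ∂μ ≤ β ^ 2) :
    ‖∫ x in s, a x * b x ∂μ‖ ≤ α * β := by
  have h2 : (2 : ℝ≥0∞) = ENNReal.ofReal 2 := by simp
  have h1 := integral_mul_norm_le_Lp_mul_Lq (μ := μ.restrict s) Real.HolderConjugate.two_two
    (h2 ▸ ha.restrict s) (h2 ▸ hb.restrict s)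
  have ha' : ∫ x in s, ‖a x‖ ^ 2 ∂μ ≤ α ^ 2 :=
    (setIntegral_le_integral ((memLp_two_iff_integrable_sq_norm ha.1).1 ha)
      (Eventually.of_forall fun x => by positivity)).trans haα
  simp only [Real.rpow_two, ← Real.sqrt_eq_rpow] at h1
  calc _ ≤ ∫ x in s, ‖a x * b x‖ ∂μ := norm_integral_le_integral_norm _
    _ = ∫ x in s, ‖a x‖ * ‖b x‖ ∂μ := by simp
    _ ≤ _ := h1
    _ ≤ α * β := by
      gcongr
      · exact Real.sqrt_le_left hα |>.2 ha'
      · exact Real.sqrt_le_left hβ |>.2 hbβ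

namespace ProjectiveRep

section Estimate

variable {G H : Type*} [Group G] [MeasurableSpace G]
  [NormedAddCommGroup H] [InnerProductSpace ℂ H] {π : ProjectiveRep G H} {μ : Measure G}

theorem IsFormalDegree.integral_norm_sq {d : ℝ} (hd : π.IsFormalDegree μ d) (g f : H) :
    MemLp (fun x => inner ℂ (π x g) f) 2 μ ∧
      ∫ x, ‖inner ℂ (π x g) f‖ ^ 2 ∂μ = d⁻¹ * ‖f‖ ^ 2 * ‖g‖ ^ 2 := by
  have h1 : ∀ x, inner ℂ (π x g) f * inner ℂ f (π x g)
      = ((‖inner ℂ (π x g) f‖ ^ 2 : ℝ) : ℂ) := fun x => by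
    rw [← inner_conj_symm f, Complex.mul_conj']
    simp
  obtain ⟨h2, h3⟩ := hd.2 f f g g
  simp only [h1] at h2 h3
  refine ⟨(memLp_two_iff_integrable_sq_norm
    (π.stronglyMeasurable_inner _ _).aestronglyMeasurable).2 h2.re, ?_⟩
  rw [integral_complex_ofReal, inner_conj_symm, inner_self_eq_ofReal, inner_self_eq_ofReal] at h3
  exact_mod_cast h3

/-- Localization of the trace of the reproducing formula: the sum of `⟨π(λ) g, h_λ⟩` over
`λ ∈ P` compared with `d μ(P)`, with an error controlled by the `C`-boundary of `P`. -/
theorem norm_sum_inner_sub_le {d : ℝ} (hd : π.IsFormalDegree μ d) {Λ : Set G} {g : H} {h : Λ → H}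
    {A B : ℝ} (hA : 0 < A) (hB : 0 < B)
    (hbessel : ∀ f, ∀ v : Finset Λ, ∑ l ∈ v, ‖inner ℂ (π l g) f‖ ^ 2 ≤ B * ‖f‖ ^ 2)
    (hdual : ∀ f, ∀ v : Finset Λ, ∑ l ∈ v, ‖inner ℂ (h l) f‖ ^ 2 ≤ A⁻¹ * ‖f‖ ^ 2)
    (hrec : ∀ f, HasSum (fun l : Λ => (inner ℂ (h l) f : ℂ) • π l g) f)
    (hnorm : ∀ l, ‖h l‖ ≤ A⁻¹ * ‖g‖)
    {P C : Set G} (hP : MeasurableSet P) (hPfin : μ P ≠ ∞)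
    (hbd : MeasurableSet (P ∩ (Pᶜ * C⁻¹))) {η : ℝ} (hη : 0 ≤ η)
    (hη₁ : ∀ (y : G) (v : Finset Λ), (∀ l ∈ v, (l : G) ∉ y • C) →
      ∑ l ∈ v, ‖inner ℂ (π l g) (π y g)‖ ^ 2 ≤ η ^ 2)
    (hη₂ : ∀ l : G, ∫ y in (l • C)ᶜ, ‖inner ℂ (π y g) (π l g)‖ ^ 2 ∂μ ≤ η ^ 2)
    (t tb : Finset Λ) (ht : ∀ l, l ∈ t ↔ (l : G) ∈ P)
    (htb : ∀ l, l ∈ tb ↔ (l : G) ∈ P ∩ (Pᶜ * C⁻¹)) :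
    ‖(d : ℂ)⁻¹ * (‖g‖ : ℂ) ^ 2 * ∑ l ∈ t, inner ℂ (h l) (π l g) - (‖g‖ : ℂ) ^ 2 * μ.real P‖
      ≤ A⁻¹ * ‖g‖ ^ 2 / √d * (η * t.card + ‖g‖ ^ 2 / √d * tb.card)
        + ‖g‖ / √A * (η * μ.real P + √B * ‖g‖ * μ.real (P ∩ (Pᶜ * C⁻¹))) := by
  classical
  have hd0 := hd.1
  set c : Λ → G → ℂ := fun l y => inner ℂ (π y g) (π l g) * inner ℂ (h l) (π y g) with hc
  have hcint : ∀ l, Integrable (c l) μ := fun l => (hd.2 (π l g) (h l) g g).1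
  have hcval : ∀ l, ∫ y, c l y ∂μ = (d : ℂ)⁻¹ * inner ℂ (h l) (π l g) * (‖g‖ : ℂ) ^ 2 := fun l => by
    have h1 := (hd.2 (π l g) (h l) g g).2
    rw [inner_conj_symm, inner_self_eq_ofReal g] at h1
    rw [h1]
    push_cast
    rfl
  -- decay of the coefficients away from `P`
  have hE₁ : ∀ l ∈ t, ‖∫ y in Pᶜ, c l y ∂μ‖
      ≤ A⁻¹ * ‖g‖ ^ 2 / √d * (η + if l ∈ tb then ‖g‖ ^ 2 / √d else 0) := by
    intro l hl
    have hcomm : ∀ y, c l y = inner ℂ (h l) (π y g) * inner ℂ (π y g) (π l g) := fun y =>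
      mul_comm _ _
    obtain ⟨ha, ha2⟩ := hd.integral_norm_sq g (h l)
    obtain ⟨hb, hb2⟩ := hd.integral_norm_sq g (π l g)
    have ha' : MemLp (fun y => inner ℂ (h l) (π y g)) 2 μ :=
      ha.congr_norm (stronglyMeasurable_const.inner (π.stronglyMeasurable g)).aestronglyMeasurable
        (Eventually.of_forall fun x => norm_inner_symm _ _)
    have hα : ∫ y, ‖inner ℂ (h l) (π y g)‖ ^ 2 ∂μ ≤ (A⁻¹ * ‖g‖ ^ 2 / √d) ^ 2 := by
      simp only [norm_inner_symm (h l)]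
      rw [ha2, div_pow, Real.sq_sqrt hd0.le, div_eq_inv_mul, mul_assoc]
      gcongr
      calc ‖h l‖ ^ 2 * ‖g‖ ^ 2 ≤ (A⁻¹ * ‖g‖) ^ 2 * ‖g‖ ^ 2 := by gcongr; exact hnorm l
        _ = _ := by ring
    simp only [hcomm]
    refine norm_setIntegral_mul_le ha' hb (by positivity) (by positivity) hα ?_
    have hbint := (memLp_two_iff_integrable_sq_norm hb.1).1 hb
    by_cases hlb : l ∈ tb
    · rw [if_pos hlb]
      calc _ ≤ ∫ y, ‖inner ℂ (π y g) (π l g)‖ ^ 2 ∂μ :=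
            setIntegral_le_integral hbint (Eventually.of_forall fun x => by positivity)
        _ = (‖g‖ ^ 2 / √d) ^ 2 := by
            rw [hb2, div_pow, Real.sq_sqrt hd0.le, LinearIsometryEquiv.norm_map]
            ring
        _ ≤ _ := by
            gcongr
            exact le_add_of_nonneg_left hη
    · rw [if_neg hlb, add_zero]
      refine le_trans ?_ (hη₂ l)
      refine setIntegral_mono_set hbint.integrableOn (Eventually.of_forall fun x => by positivity)
        (LE.le.eventuallyLE ?_)
      -- If `y ∉ P` lies in `lC`, then `l = yq⁻¹` with `q ∈ C`, so `l ∈ Pᶜ * C⁻¹`. Away from the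
      -- boundary only the tail outside `lC` remains.
      intro y hy hmem
      obtain ⟨q, hq, rfl⟩ := hmem
      refine hlb ((htb l).2 ⟨(ht l).1 hl, ⟨_, hy, q⁻¹, by simpa using hq, ?_⟩⟩)
      simp
  -- truncation of the reproducing formula at points of `P`
  have hE₂ : ∀ y ∈ P, ‖(‖g‖ : ℂ) ^ 2 - ∑ l ∈ t, c l y‖
      ≤ ‖g‖ / √A * (η + (P ∩ (Pᶜ * C⁻¹)).indicator (fun _ => √B * ‖g‖) y) := by
    intro y hy
    have hs : HasSum (fun l : Λ => inner ℂ (h l) (π y g) * inner ℂ (π y g) (π l g))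
        ((‖g‖ : ℂ) ^ 2) := by
      have h1 := (hrec (π y g)).mapL (innerSL ℂ (π y g))
      simp only [map_smul, innerSL_apply_apply, smul_eq_mul] at h1
      rw [inner_self_eq_ofReal, LinearIsometryEquiv.norm_map] at h1
      simpa using h1
    have hcs : ∑ l ∈ t, c l y = ∑ l ∈ t, inner ℂ (h l) (π y g) * inner ℂ (π y g) (π l g) :=
      Finset.sum_congr rfl fun l _ => mul_comm _ _
    rw [hcs]
    have hind : 0 ≤ (P ∩ (Pᶜ * C⁻¹)).indicator (fun _ => √B * ‖g‖) y :=
      Set.indicator_nonneg (fun _ _ => by positivity) y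
    refine norm_hasSum_sub_sum_le hs t (by positivity) (by positivity) (fun v => ?_)
      (fun v hv => ?_)
    · refine (hdual _ v).trans_eq ?_
      rw [div_pow, Real.sq_sqrt hA.le, LinearIsometryEquiv.norm_map, div_eq_inv_mul]
    · simp only [norm_inner_symm (π y g)]
      by_cases hyb : y ∈ P ∩ (Pᶜ * C⁻¹)
      · rw [Set.indicator_of_mem hyb]
        refine (hbessel _ v).trans ?_
        rw [LinearIsometryEquiv.norm_map]
        calc B * ‖g‖ ^ 2 = (√B * ‖g‖) ^ 2 := by rw [mul_pow, Real.sq_sqrt hB.le]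
          _ ≤ _ := by
            gcongr
            exact le_add_of_nonneg_left hη
      · rw [Set.indicator_of_notMem hyb, add_zero]
        refine hη₁ y v fun l hl hmem => hyb ⟨hy, ?_⟩
        obtain ⟨q, hq, hql⟩ := hmem
        refine ⟨l, fun hlP => ?_, q⁻¹, by simpa using hq, ?_⟩
        · exact Finset.disjoint_left.1 hv hl ((ht l).2 hlP)
        · simp [← hql]
  have hconst : IntegrableOn (fun _ : G => (‖g‖ : ℂ) ^ 2) P μ := integrableOn_const hPfin
  have hsumint : IntegrableOn (fun y => ∑ l ∈ t, c l y) P μ :=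
    integrable_finsetSum _ fun l _ => (hcint l).integrableOn
  -- Both terms on the left are compared with the sum of `c l y` over `t × P`. The first exceeds it
  -- by the integrals over `Pᶜ`; the second exceeds it by the terms of the reproducing series
  -- outside `t`.
  have hident : (d : ℂ)⁻¹ * (‖g‖ : ℂ) ^ 2 * ∑ l ∈ t, inner ℂ (h l) (π l g)
      - (‖g‖ : ℂ) ^ 2 * μ.real P
      = ∑ l ∈ t, ∫ y in Pᶜ, c l y ∂μ - ∫ y in P, ((‖g‖ : ℂ) ^ 2 - ∑ l ∈ t, c l y) ∂μ := by
    rw [integral_sub hconst hsumint, setIntegral_const, Complex.real_smul,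
      integral_finsetSum _ fun l _ => (hcint l).integrableOn]
    have h1 : ∑ l ∈ t, ∫ y, c l y ∂μ
        = ∑ l ∈ t, ∫ y in P, c l y ∂μ + ∑ l ∈ t, ∫ y in Pᶜ, c l y ∂μ := by
      rw [← Finset.sum_add_distrib]
      exact Finset.sum_congr rfl fun l _ => (integral_add_compl hP (hcint l)).symm
    have h2 : ∑ l ∈ t, ∫ y, c l y ∂μ
        = (d : ℂ)⁻¹ * (‖g‖ : ℂ) ^ 2 * ∑ l ∈ t, inner ℂ (h l) (π l g) := by
      rw [Finset.mul_sum]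
      exact Finset.sum_congr rfl fun l _ => by rw [hcval]; ring
    linear_combination h1 - h2
  rw [hident]
  refine (norm_sub_le _ _).trans (add_le_add ?_ ?_)
  · refine (norm_sum_le_of_le _ hE₁).trans_eq ?_
    have htt : t.filter (· ∈ tb) = tb := by
      ext l
      simp only [Finset.mem_filter, ht, htb, Set.mem_inter_iff]
      tauto
    rw [← Finset.mul_sum, Finset.sum_add_distrib, ← Finset.sum_filter, htt, Finset.sum_const,
      Finset.sum_const, nsmul_eq_mul, nsmul_eq_mul]
    ring
  · have hk : ∀ k : ℝ, Integrable (fun _ : G => k) (μ.restrict P) := fun k =>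
      integrableOn_const hPfin
    have hbint : Integrable (fun y => ‖g‖ / √A *
        (η + (P ∩ (Pᶜ * C⁻¹)).indicator (fun _ => √B * ‖g‖) y)) (μ.restrict P) :=
      ((hk _).add ((hk _).indicator hbd)).const_mul _
    refine (norm_integral_le_of_norm_le hbint ((ae_restrict_iff' hP).2
      (Eventually.of_forall hE₂))).trans_eq ?_
    rw [integral_const_mul, integral_add (hk _) ((hk _).indicator hbd), setIntegral_const,
      integral_indicator_const _ hbd,
      smul_eq_mul, smul_eq_mul, measureReal_restrict_apply hbd,
      Set.inter_eq_left.2 Set.inter_subset_left]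
    ring

end Estimate

end ProjectiveRep

/-! ### Limits of infima and suprema of quotients. -/

section Quotients

variable {X : Type*} [Nonempty X] {s T : ℕ → X → ℝ} {d D : ℝ}

theorem tendsto_iInf_div (hd : 0 < d) (hD : 0 < D)
    (hT : ∀ ε > 0, ∀ᶠ n in atTop, ∀ x, |T n x - d| ≤ ε)
    (hpos : ∀ᶠ n in atTop, ∀ x, 0 < s n x)
    (hup : ∀ ε > 0, ∀ᶠ n in atTop, ∀ x, s n x ≤ D + ε)
    (hex : ∀ ε > 0, ∀ᶠ n in atTop, ∃ x, D - ε ≤ s n x) :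
    Tendsto (fun n => ⨅ x, T n x / s n x) atTop (𝓝 (d / D)) := by
  have hsmall : ∀ r : ℝ, 0 < r → ∀ᶠ ε in 𝓝[>] (0 : ℝ), 0 < ε ∧ ε < r := fun r hr =>
    (eventually_mem_nhdsWithin.and (eventually_nhdsWithin_of_eventually_nhds
      (eventually_lt_nhds hr)))
  refine tendsto_order.2 ⟨fun a ha => ?_, fun b hb => ?_⟩
  · have hc : Tendsto (fun ε : ℝ => (d - ε) / (D + ε)) (𝓝[>] 0) (𝓝 (d / D)) := by
      have : ContinuousAt (fun ε : ℝ => (d - ε) / (D + ε)) 0 :=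
        (by fun_prop : ContinuousAt (fun ε : ℝ => d - ε) 0).div (by fun_prop) (by simpa using hD.ne')
      simpa using this.tendsto.mono_left nhdsWithin_le_nhds
    obtain ⟨ε, hε, hε0, hεd⟩ := ((hc.eventually_const_lt ha).and (hsmall d hd)).exists
    filter_upwards [hT ε hε0, hpos, hup ε hε0] with n h1 h2 h3
    refine hε.trans_le (le_ciInf fun x => ?_)
    have := (abs_le.1 (h1 x)).1
    exact div_le_div₀ (by linarith) (by linarith) (h2 x) (h3 x)
  · have hc : Tendsto (fun ε : ℝ => (d + ε) / (D - ε)) (𝓝[>] 0) (𝓝 (d / D)) := by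
      have : ContinuousAt (fun ε : ℝ => (d + ε) / (D - ε)) 0 :=
        (by fun_prop : ContinuousAt (fun ε : ℝ => d + ε) 0).div (by fun_prop) (by simpa using hD.ne')
      simpa using this.tendsto.mono_left nhdsWithin_le_nhds
    obtain ⟨ε, hε, hε0, hεD⟩ := ((hc.eventually_lt_const hb).and (hsmall D hD)).exists
    -- Taking the tolerance equal to `d` makes every numerator nonnegative, which supplies the lower
    -- bound needed for the real-valued infimum.
    filter_upwards [hT ε hε0, hpos, hex ε hε0, hT d hd] with n h1 h2 ⟨x, hx⟩ h4
    refine lt_of_le_of_lt (ciInf_le ⟨0, ?_⟩ x) (lt_of_le_of_lt ?_ hε)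
    · rintro _ ⟨y, rfl⟩
      have := (abs_le.1 (h4 y)).1
      exact div_nonneg (by linarith) (h2 y).le
    · have := (abs_le.1 (h1 x)).2
      exact div_le_div₀ (by linarith) (by linarith) (by linarith) hx

theorem tendsto_iSup_div (hd : 0 < d) (hD : 0 < D)
    (hT : ∀ ε > 0, ∀ᶠ n in atTop, ∀ x, |T n x - d| ≤ ε)
    (hlow : ∀ ε > 0, ∀ᶠ n in atTop, ∀ x, D - ε ≤ s n x)
    (hex : ∀ ε > 0, ∀ᶠ n in atTop, ∃ x, s n x ≤ D + ε) :
    Tendsto (fun n => ⨆ x, T n x / s n x) atTop (𝓝 (d / D)) := by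
  have hsmall : ∀ r : ℝ, 0 < r → ∀ᶠ ε in 𝓝[>] (0 : ℝ), 0 < ε ∧ ε < r := fun r hr =>
    (eventually_mem_nhdsWithin.and (eventually_nhdsWithin_of_eventually_nhds
      (eventually_lt_nhds hr)))
  have hbound : ∀ ε, 0 < ε → ε < D → ∀ᶠ n in atTop, ∀ x, T n x / s n x ≤ (d + ε) / (D - ε) := by
    intro ε hε0 hεD
    filter_upwards [hT ε hε0, hlow ε hε0] with n h1 h2 x
    have := (abs_le.1 (h1 x)).2
    exact div_le_div₀ (by linarith) (by linarith) (by linarith) (h2 x)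
  refine tendsto_order.2 ⟨fun a ha => ?_, fun b hb => ?_⟩
  · have hc : Tendsto (fun ε : ℝ => (d - ε) / (D + ε)) (𝓝[>] 0) (𝓝 (d / D)) := by
      have : ContinuousAt (fun ε : ℝ => (d - ε) / (D + ε)) 0 :=
        (by fun_prop : ContinuousAt (fun ε : ℝ => d - ε) 0).div (by fun_prop) (by simpa using hD.ne')
      simpa using this.tendsto.mono_left nhdsWithin_le_nhds
    obtain ⟨ε, hε, ⟨hε0, hεd⟩, -, hεD⟩ :=
      ((hc.eventually_const_lt ha).and ((hsmall d hd).and (hsmall D hD))).exists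
    filter_upwards [hT ε hε0, hlow ε hε0, hex ε hε0, hbound ε hε0 hεD] with n h1 h2 ⟨x, hx⟩ h4
    refine lt_of_lt_of_le hε (le_trans ?_ (le_ciSup ⟨_, Set.forall_mem_range.2 h4⟩ x))
    have := (abs_le.1 (h1 x)).1
    exact div_le_div₀ (by linarith) (by linarith) (by linarith [h2 x]) hx
  · have hc : Tendsto (fun ε : ℝ => (d + ε) / (D - ε)) (𝓝[>] 0) (𝓝 (d / D)) := by
      have : ContinuousAt (fun ε : ℝ => (d + ε) / (D - ε)) 0 :=
        (by fun_prop : ContinuousAt (fun ε : ℝ => d + ε) 0).div (by fun_prop) (by simpa using hD.ne')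
      simpa using this.tendsto.mono_left nhdsWithin_le_nhds
    obtain ⟨ε, hε, hε0, hεD⟩ := ((hc.eventually_lt_const hb).and (hsmall D hD)).exists
    filter_upwards [hbound ε hε0 hεD] with n h1
    exact (ciSup_le h1).trans_lt hε

end Quotients

/-! ### Uniform asymptotics along a strong Følner sequence. -/

section Uniform

variable {G : Type*} [Group G] [TopologicalSpace G] [IsTopologicalGroup G] [T2Space G]
    [LocallyCompactSpace G] [SecondCountableTopology G] [MeasurableSpace G] [BorelSpace G]
    {μ : Measure G} [μ.IsHaarMeasure]
    {H : Type*} [NormedAddCommGroup H] [InnerProductSpace ℂ H] {π : ProjectiveRep G H}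

/-- The modulus of `⟨π(l)g, π(y)g⟩` depends only on `l⁻¹y`, so tightness of the single integrable
function `|V_g g|²` is uniform in `l`. -/
theorem exists_isCompact_setIntegral_compl_smul_le {d : ℝ} (hd : π.IsFormalDegree μ d) (g : H)
    {ε : ℝ} (hε : 0 < ε) :
    ∃ C : Set G, IsCompact C ∧
      ∀ l : G, ∫ y in (l • C)ᶜ, ‖inner ℂ (π y g) (π l g)‖ ^ 2 ∂μ ≤ ε := by
  obtain ⟨hm, -⟩ := hd.integral_norm_sq g g
  have hint := (memLp_two_iff_integrable_sq_norm hm.1).1 hm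
  have hnn : ∀ x, 0 ≤ ‖inner ℂ (π x g) g‖ ^ 2 := fun x => by positivity
  obtain ⟨C, hC, hlt⟩ := exists_isCompact_setLIntegral_compl_lt
    (h := fun x => ENNReal.ofReal (‖inner ℂ (π x g) g‖ ^ 2)) (μ := μ) (by
      rw [← ofReal_integral_eq_lintegral_ofReal hint (Eventually.of_forall hnn)]
      simp) (ε := ENNReal.ofReal ε) (by simpa using hε)
  refine ⟨C, hC, fun l => ?_⟩
  simp only [π.norm_inner_map_map]
  have hset : (l • C)ᶜ = (fun y => l⁻¹ * y) ⁻¹' Cᶜ := by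
    ext y
    simp [Set.mem_smul_set_iff_inv_smul_mem]
  rw [hset, (measurePreserving_mul_left μ l⁻¹).setIntegral_preimage_emb
    (measurableEmbedding_mulLeft l⁻¹) (fun y => ‖inner ℂ (π y g) g‖ ^ 2)]
  rw [← ofReal_integral_eq_lintegral_ofReal hint.integrableOn (Eventually.of_forall hnn)] at hlt
  exact ((ENNReal.ofReal_lt_ofReal_iff hε).1 hlt).le

/-- Counting points of `Λ` in the `C`-boundary requires thickening it by `U⁻¹`. The result is still
contained in a boundary set of the kind that the strong Følner condition controls. -/
theorem boundary_mul_subset {G : Type*} [Group G] (K C U : Set G) :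
    (K ∩ (Kᶜ * C⁻¹)) * U⁻¹ ⊆
      (K * (U⁻¹ ∪ C⁻¹ * U⁻¹)) ∩ (Kᶜ * (U⁻¹ ∪ C⁻¹ * U⁻¹)) := by
  rintro _ ⟨z, ⟨hz, hz'⟩, u, hu, rfl⟩
  refine ⟨⟨z, hz, u, Or.inl hu, rfl⟩, ?_⟩
  obtain ⟨k, hk, q, hq, rfl⟩ := hz'
  exact ⟨k, hk, q * u, Or.inr ⟨q, hq, u, hu, rfl⟩, (mul_assoc _ _ _).symm⟩

variable [μ.IsMulRightInvariant]

/-- Point counts in translates of a set are controlled by the measure of a thickening. -/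
theorem card_mul_measureReal_le {Λ U : Set G} (hΛ : Λ.Countable) (hUc : IsCompact U) {N : ℕ}
    (hN : ∀ x : G, (Λ ∩ x • U).encard ≤ N) {S : Set G} (hS : μ (S * U⁻¹) ≠ ∞) (x : G)
    {t : Finset Λ} (ht : ∀ l ∈ t, (l : G) ∈ x • S) :
    (t.card : ℝ) * μ.real U ≤ N * μ.real (S * U⁻¹) := by
  have h1 := encard_inter_mul_le μ hΛ S hUc x
  have h2 : (t.card : ℝ≥0∞) * μ U ≤ μ (S * U⁻¹) * N := by
    refine le_trans ?_ (h1.trans ?_)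
    · gcongr
      have : (t.card : ℕ∞) ≤ (Λ ∩ x • S).encard := by
        rw [← Set.encard_coe_eq_coe_finsetCard, ← Subtype.val_injective.encard_image]
        refine Set.encard_le_encard ?_
        rintro _ ⟨l, hl, rfl⟩
        exact ⟨l.2, ht l hl⟩
      exact_mod_cast this
    · gcongr
      refine iSup_le fun y => ?_
      exact_mod_cast hN y
  have h3 := ENNReal.toReal_mono (by finiteness) h2
  rw [ENNReal.toReal_mul, ENNReal.toReal_mul] at h3
  simpa [Measure.real, mul_comm] using h3

/-- Along a strong Følner sequence the sums of `⟨π(λ) g, h_λ⟩` over `λ ∈ x Kₙ` are asymptotic to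
`d μ(Kₙ)`, uniformly in `x`. -/
theorem eventually_abs_sum_re_inner_sub_le {K : ℕ → Set G} (hK : IsStrongFolner μ K)
    {d : ℝ} (hd : π.IsFormalDegree μ d) {Λ : Set G} (hΛ : Λ.Countable) {g : H} (hg : g ≠ 0)
    {h : Λ → H} {A B : ℝ} (hA : 0 < A) (hB : 0 < B)
    (hbessel : ∀ f, ∀ v : Finset Λ, ∑ l ∈ v, ‖inner ℂ (π l g) f‖ ^ 2 ≤ B * ‖f‖ ^ 2)
    (hdual : ∀ f, ∀ v : Finset Λ, ∑ l ∈ v, ‖inner ℂ (h l) f‖ ^ 2 ≤ A⁻¹ * ‖f‖ ^ 2)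
    (hrec : ∀ f, HasSum (fun l : Λ => (inner ℂ (h l) f : ℂ) • π l g) f)
    (hnorm : ∀ l, ‖h l‖ ≤ A⁻¹ * ‖g‖)
    {U : Set G} (hU : U ∈ 𝓝 (1 : G)) (hUc : IsCompact U) {N : ℕ}
    (hN : ∀ x : G, (Λ ∩ x • U).encard ≤ N)
    (htail : ∀ ε > 0, ∃ C : Set G, IsCompact C ∧ ∀ (y : G) (v : Finset Λ),
      (∀ l ∈ v, (l : G) ∉ y • C) → ∑ l ∈ v, ‖inner ℂ (π l g) (π y g)‖ ^ 2 ≤ ε)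
    {κ : ℝ} (hκ : 0 ≤ κ) (hcount : ∀ᶠ n in atTop, ∀ (x : G) (t : Finset Λ),
      (∀ l, l ∈ t ↔ (l : G) ∈ x • K n) → (t.card : ℝ) ≤ κ * μ.real (K n))
    {ε : ℝ} (hε : 0 < ε) :
    ∀ᶠ n in atTop, ∀ (x : G) (t : Finset Λ), (∀ l, l ∈ t ↔ (l : G) ∈ x • K n) →
      |∑ l ∈ t, (inner ℂ (h l) (π l g)).re - d * μ.real (K n)| ≤ ε * μ.real (K n) := by
  classical
  have hd0 := hd.1
  have hg' : 0 < ‖g‖ := norm_pos_iff.2 hg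
  have hU0 : 0 < μ.real U :=
    ENNReal.toReal_pos (Measure.measure_pos_of_mem_nhds μ hU).ne' hUc.measure_ne_top
  set M₁ := A⁻¹ * ‖g‖ ^ 2 / √d with hM₁
  set M₂ := ‖g‖ ^ 2 / √d with hM₂
  set α := ‖g‖ / √A with hα
  set β := √B * ‖g‖ with hβ
  set R := d / ‖g‖ ^ 2 with hR
  have hM₁0 : 0 ≤ M₁ := by positivity
  have hM₂0 : 0 ≤ M₂ := by positivity
  have hα0 : 0 ≤ α := by positivity
  have hβ0 : 0 ≤ β := by positivity
  have hR0 : 0 < R := by positivity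
  set X₁ := R * (M₁ * κ + α) with hX₁
  set X₂ := R * (M₁ * M₂ * (N / μ.real U) + α * β) with hX₂
  have hX₁0 : 0 ≤ X₁ := by positivity
  have hX₂0 : 0 ≤ X₂ := by positivity
  set η := ε / (2 * (X₁ + 1)) with hη
  have hη0 : 0 < η := by positivity
  have hX₁η : X₁ * η ≤ ε / 2 := by
    rw [hη, ← mul_div_assoc, div_le_div_iff₀ (by positivity) (by positivity)]
    nlinarith
  obtain ⟨C₁, hC₁, htail₁⟩ := htail (η ^ 2) (by positivity)
  obtain ⟨C₂, hC₂, htail₂⟩ := exists_isCompact_setIntegral_compl_smul_le hd g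
    (ε := η ^ 2) (by positivity)
  set C := C₁ ∪ C₂ with hCdef
  have hC : IsCompact C := hC₁.union hC₂
  have hη₁ : ∀ (y : G) (v : Finset Λ), (∀ l ∈ v, (l : G) ∉ y • C) →
      ∑ l ∈ v, ‖inner ℂ (π l g) (π y g)‖ ^ 2 ≤ η ^ 2 := fun y v hv =>
    htail₁ y v fun l hl hmem => hv l hl (Set.smul_set_mono Set.subset_union_left hmem)
  have hη₂ : ∀ l : G, ∫ y in (l • C)ᶜ, ‖inner ℂ (π y g) (π l g)‖ ^ 2 ∂μ ≤ η ^ 2 := fun l => by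
    refine le_trans ?_ (htail₂ l)
    have hm := (hd.integral_norm_sq g (π l g)).1
    refine setIntegral_mono_set ((memLp_two_iff_integrable_sq_norm hm.1).1 hm).integrableOn
      (Eventually.of_forall fun x => by positivity) (LE.le.eventuallyLE ?_)
    exact Set.compl_subset_compl.2 (Set.smul_set_mono Set.subset_union_right)
  set W := U⁻¹ ∪ C⁻¹ * U⁻¹ with hW
  have hWc : IsCompact W := hUc.inv.union (hC.inv.mul hUc.inv)
  have hlim := hK.tendsto_boundary W hWc
  have hδ : 0 < ε / (2 * (X₂ + 1)) := by positivity
  filter_upwards [hcount, hlim.eventually_lt_const (ENNReal.ofReal_pos.2 hδ)] with n hn hbn x t ht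
  have hKc := hK.isCompact n
  have hKt : μ (K n) ≠ ∞ := hKc.measure_ne_top
  have hK0 : 0 < μ.real (K n) := ENNReal.toReal_pos (hK.measure_ne_zero n) hKt
  set S := K n ∩ ((K n)ᶜ * C⁻¹) with hS
  have hSeq : x • K n ∩ ((x • K n)ᶜ * C⁻¹) = x • S := by
    rw [hS, Set.smul_set_inter, ← smul_mul_assoc, Set.smul_set_compl]
  have hSUt : μ (S * U⁻¹) ≠ ∞ :=
    ((measure_mono (Set.mul_subset_mul_right Set.inter_subset_left)).trans_lt
      (hKc.mul hUc.inv).measure_lt_top).ne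
  have hSU : μ.real (S * U⁻¹) ≤ ε / (2 * (X₂ + 1)) * μ.real (K n) := by
    have h1 : μ (S * U⁻¹) ≤ ENNReal.ofReal (ε / (2 * (X₂ + 1))) * μ (K n) := by
      refine (measure_mono (boundary_mul_subset (K n) C U)).trans ?_
      rw [← ENNReal.div_le_iff (hK.measure_ne_zero n) hKt]
      exact hbn.le
    have h2 := ENNReal.toReal_mono (by finiteness) h1
    rwa [ENNReal.toReal_mul, ENNReal.toReal_ofReal hδ.le] at h2
  have hSle : μ.real S ≤ μ.real (S * U⁻¹) := by
    refine measureReal_mono (fun z hz => ⟨z, hz, 1, ?_, mul_one z⟩) hSUt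
    simpa using mem_of_mem_nhds hU
  set tb := t.filter fun l : Λ => (l : G) ∈ x • S with htb
  have htbm : ∀ l, l ∈ tb ↔ (l : G) ∈ x • K n ∩ ((x • K n)ᶜ * C⁻¹) := fun l => by
    rw [hSeq, htb, Finset.mem_filter, ht]
    exact ⟨fun h => h.2, fun h => ⟨Set.smul_set_mono Set.inter_subset_left h, h⟩⟩
  have hSm : MeasurableSet (x • K n ∩ ((x • K n)ᶜ * C⁻¹)) :=
    (hKc.smul x).measurableSet.inter (hKc.smul x).isClosed.isOpen_compl.mul_right.measurableSet
  have hxK : μ (x • K n) = μ (K n) := measure_smul _ _ _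
  have key := ProjectiveRep.norm_sum_inner_sub_le hd hA hB hbessel hdual hrec hnorm
    (hKc.smul x).measurableSet (by rw [hxK]; exact hKt) hSm hη0.le hη₁ hη₂ t tb ht htbm
  have hrP : μ.real (x • K n) = μ.real (K n) := by rw [Measure.real, hxK, Measure.real]
  have hrS : μ.real (x • S) = μ.real S := by rw [Measure.real, measure_smul, Measure.real]
  rw [hSeq, hrP, hrS] at key
  have htbc : (tb.card : ℝ) ≤ N / μ.real U * μ.real (S * U⁻¹) := by
    rw [div_mul_eq_mul_div, le_div_iff₀ hU0]
    exact card_mul_measureReal_le hΛ hUc hN hSUt x fun l hl => (Finset.mem_filter.1 hl).2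
  have hre : (d⁻¹ * ‖g‖ ^ 2) * |∑ l ∈ t, (inner ℂ (h l) (π l g)).re - d * μ.real (K n)|
      ≤ ‖(d : ℂ)⁻¹ * (‖g‖ : ℂ) ^ 2 * ∑ l ∈ t, inner ℂ (h l) (π l g)
        - (‖g‖ : ℂ) ^ 2 * μ.real (K n)‖ := by
    refine le_trans (le_of_eq ?_) (Complex.abs_re_le_norm _)
    have h1 : (d : ℂ)⁻¹ * (‖g‖ : ℂ) ^ 2 * ∑ l ∈ t, inner ℂ (h l) (π l g)
        - (‖g‖ : ℂ) ^ 2 * μ.real (K n)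
        = ((d⁻¹ * ‖g‖ ^ 2 : ℝ) : ℂ) * ∑ l ∈ t, inner ℂ (h l) (π l g)
          - ((‖g‖ ^ 2 * μ.real (K n) : ℝ) : ℂ) := by push_cast; rfl
    rw [h1, Complex.sub_re, Complex.re_ofReal_mul, Complex.ofReal_re, Complex.re_sum,
      ← abs_of_pos (a := d⁻¹ * ‖g‖ ^ 2) (by positivity), ← abs_mul,
      abs_of_pos (a := d⁻¹ * ‖g‖ ^ 2) (by positivity)]
    congr 1
    field_simp
  have hRinv : R * (d⁻¹ * ‖g‖ ^ 2) = 1 := by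
    rw [hR]
    field_simp
  calc |∑ l ∈ t, (inner ℂ (h l) (π l g)).re - d * μ.real (K n)|
      = R * ((d⁻¹ * ‖g‖ ^ 2) * |∑ l ∈ t, (inner ℂ (h l) (π l g)).re - d * μ.real (K n)|) := by
        rw [← mul_assoc, hRinv, one_mul]
    _ ≤ R * (M₁ * (η * t.card + M₂ * tb.card) + α * (η * μ.real (K n) + β * μ.real S)) := by
        gcongr
        exact hre.trans key
    _ ≤ R * (M₁ * (η * (κ * μ.real (K n)) + M₂ * (N / μ.real U * μ.real (S * U⁻¹)))
          + α * (η * μ.real (K n) + β * μ.real (S * U⁻¹))) := by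
        gcongr
        exact hn x t ht
    _ = X₁ * η * μ.real (K n) + X₂ * μ.real (S * U⁻¹) := by
        rw [hX₁, hX₂]
        ring
    _ ≤ ε / 2 * μ.real (K n) + X₂ * (ε / (2 * (X₂ + 1)) * μ.real (K n)) := by gcongr
    _ ≤ ε / 2 * μ.real (K n) + ε / 2 * μ.real (K n) := by
        rw [← mul_assoc]
        gcongr
        rw [← mul_div_assoc, div_le_div_iff₀ (by positivity) (by positivity)]
        nlinarith
    _ = ε * μ.real (K n) := by ring

end Uniform

/-! ### From densities to real bounds; finiteness and absence of holes. -/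

/-- Uniform real bounds extracted from convergence of suprema in `ℝ≥0∞`. -/
theorem eventually_of_tendsto_iSup_ofReal {X : Type*} {s : ℕ → X → ℝ} {D : ℝ≥0} (hD : 0 < D)
    (h : Tendsto (fun n => ⨆ x, ENNReal.ofReal (s n x)) atTop (𝓝 (D : ℝ≥0∞))) {ε : ℝ}
    (hε : 0 < ε) :
    (∀ᶠ n in atTop, ∀ x, s n x ≤ D + ε) ∧ ∀ᶠ n in atTop, ∃ x, D - ε ≤ s n x := by
  have hD' : (D : ℝ≥0∞) = ENNReal.ofReal D := by simp
  rw [hD'] at h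
  have hD0 : (0 : ℝ) < D := hD
  constructor
  · have h1 : ENNReal.ofReal D < ENNReal.ofReal (D + ε) :=
      (ENNReal.ofReal_lt_ofReal_iff (by positivity)).2 (by linarith)
    filter_upwards [h.eventually_lt_const h1] with n hn x
    exact (ENNReal.ofReal_le_ofReal_iff (by positivity)).1
      ((le_iSup (fun x => ENNReal.ofReal (s n x)) x).trans hn.le)
  · have h1 : ENNReal.ofReal (D - ε) < ENNReal.ofReal D :=
      (ENNReal.ofReal_lt_ofReal_iff hD0).2 (by linarith)
    filter_upwards [h.eventually_const_lt h1] with n hn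
    obtain ⟨x, hx⟩ := lt_iSup_iff.1 hn
    exact ⟨x, (ENNReal.ofReal_lt_ofReal_iff'.1 hx).1.le⟩

/-- Uniform real bounds extracted from convergence of infima in `ℝ≥0∞`. -/
theorem eventually_of_tendsto_iInf_ofReal {X : Type*} {s : ℕ → X → ℝ} {D : ℝ≥0} (hD : 0 < D)
    (hs : ∀ n x, 0 ≤ s n x)
    (h : Tendsto (fun n => ⨅ x, ENNReal.ofReal (s n x)) atTop (𝓝 (D : ℝ≥0∞))) {ε : ℝ}
    (hε : 0 < ε) :
    (∀ᶠ n in atTop, ∀ x, D - ε ≤ s n x) ∧ ∀ᶠ n in atTop, ∃ x, s n x ≤ D + ε := by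
  have hD' : (D : ℝ≥0∞) = ENNReal.ofReal D := by simp
  rw [hD'] at h
  have hD0 : (0 : ℝ) < D := hD
  constructor
  · have h1 : ENNReal.ofReal (D - ε) < ENNReal.ofReal D :=
      (ENNReal.ofReal_lt_ofReal_iff hD0).2 (by linarith)
    filter_upwards [h.eventually_const_lt h1] with n hn x
    exact (ENNReal.ofReal_le_ofReal_iff (hs n x)).1
      (hn.le.trans (iInf_le (fun x => ENNReal.ofReal (s n x)) x))
  · have h1 : ENNReal.ofReal D < ENNReal.ofReal (D + ε) :=
      (ENNReal.ofReal_lt_ofReal_iff (by positivity)).2 (by linarith)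
    filter_upwards [h.eventually_lt_const h1] with n hn
    obtain ⟨x, hx⟩ := iInf_lt_iff.1 hn
    exact ⟨x, (ENNReal.ofReal_lt_ofReal_iff'.1 hx).1.le⟩

theorem IsFrame.ne_zero {G H : Type*} [Group G] [MeasurableSpace G] [NormedAddCommGroup H]
    [InnerProductSpace ℂ H] [Nontrivial H] {π : ProjectiveRep G H} {Λ : Set G} {g : H}
    (h : IsFrame (π.coherentSystem Λ g)) : g ≠ 0 := by
  rintro rfl
  obtain ⟨A, B, hA, -, h⟩ := h
  obtain ⟨u, hu⟩ := exists_ne (0 : H)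
  have h1 := (h u).2.1
  simp only [ProjectiveRep.coherentSystem, map_zero, inner_zero_left, norm_zero] at h1
  have : 0 < A * ‖u‖ ^ 2 := by positivity
  simp at h1
  linarith

section Main

variable {G : Type*} [Group G] [TopologicalSpace G] [IsTopologicalGroup G] [T2Space G]
    [LocallyCompactSpace G] [SecondCountableTopology G] [MeasurableSpace G] [BorelSpace G]
    {μ : Measure G} [μ.IsHaarMeasure] [μ.IsMulRightInvariant]
    {H : Type*} [NormedAddCommGroup H] [InnerProductSpace ℂ H] {π : ProjectiveRep G H}

theorem finite_inter_smul (μ : Measure G) [μ.IsHaarMeasure] [μ.IsMulRightInvariant]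
    {Λ U : Set G} (hΛ : Λ.Countable) (hU : U ∈ 𝓝 (1 : G)) (hUc : IsCompact U) {N : ℕ}
    (hN : ∀ x : G, (Λ ∩ x • U).encard ≤ N) {K : Set G}
    (hK : IsCompact K) (x : G) : (Λ ∩ x • K).Finite := by
  have h1 := encard_inter_mul_le μ hΛ K hUc x
  have hU0 : μ U ≠ 0 := (Measure.measure_pos_of_mem_nhds μ hU).ne'
  have h2 : ⨆ y : G, ((Λ ∩ y • U).encard : ℝ≥0∞) ≤ N := iSup_le fun y => by exact_mod_cast hN y
  have h3 : ((Λ ∩ x • K).encard : ℝ≥0∞) * μ U < ∞ :=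
    h1.trans_lt (ENNReal.mul_lt_top (hK.mul hUc.inv).measure_lt_top
      (h2.trans_lt (ENNReal.natCast_lt_top N)))
  rw [← Set.encard_lt_top_iff]
  by_contra htop
  rw [not_lt_top_iff] at htop
  rw [htop, ENat.toENNReal_top, ENNReal.top_mul hU0] at h3
  exact lt_irrefl _ h3

/-- The sampled coefficients of a vector in the amalgam class have uniformly small tails. -/
theorem exists_isCompact_sum_norm_inner_sq_le {Q : Set G} (hQn : Q ∈ 𝓝 (1 : G)) {g : H}
    (hg : π.MemB2 μ Q g) {Λ U : Set G} {N : ℕ} (hU : U ∈ 𝓝 (1 : G)) (hUc : IsCompact U)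
    (hN : ∀ x : G, (Λ ∩ x • U).encard ≤ N) {ε : ℝ} (hε : 0 < ε) :
    ∃ C : Set G, IsCompact C ∧ ∀ (y : G) (v : Finset Λ), (∀ l ∈ v, (l : G) ∉ y • C) →
      ∑ l ∈ v, ‖inner ℂ (π l g) (π y g)‖ ^ 2 ≤ ε := by
  obtain ⟨C, hC, h⟩ := exists_isCompact_tail_le (F := π.coeff g g)
    (π.continuous_norm_inner μ g g) hQn hg.lintegral_lt_top hU hUc hN hε
  refine ⟨C, hC, fun y v hv => ?_⟩
  simp only [π.norm_inner_map_map]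
  exact h y v hv

/-- If `Λ` missed `yC`, all frame coefficients of `π(y)g` would belong to the tail, whose total is
half of what the lower frame bound requires. -/
theorem inter_smul_nonempty_of_tail {G H : Type*} [Group G] [MeasurableSpace G]
    [NormedAddCommGroup H] [InnerProductSpace ℂ H] {π : ProjectiveRep G H}
    {Λ C : Set G} {g : H} (hg : g ≠ 0) {A : ℝ} (hA : 0 < A)
    (hlow : ∀ f, A * ‖f‖ ^ 2 ≤ ∑' l : Λ, ‖inner ℂ (π l g) f‖ ^ 2)
    (hC : ∀ (y : G) (v : Finset Λ), (∀ l ∈ v, (l : G) ∉ y • C) →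
      ∑ l ∈ v, ‖inner ℂ (π l g) (π y g)‖ ^ 2 ≤ A * ‖g‖ ^ 2 / 2) (y : G) :
    (Λ ∩ y • C).Nonempty := by
  by_contra hne
  rw [Set.not_nonempty_iff_eq_empty] at hne
  have hpos : 0 < A * ‖g‖ ^ 2 := by positivity
  have h1 : ∑' l : Λ, ‖inner ℂ (π l g) (π y g)‖ ^ 2 ≤ A * ‖g‖ ^ 2 / 2 := by
    refine Real.tsum_le_of_sum_le (fun l => by positivity) fun v => hC y v fun l _ hl => ?_
    exact Set.notMem_empty (l : G) (hne ▸ ⟨l.2, hl⟩)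
  have h2 := hlow (π y g)
  rw [LinearIsometryEquiv.norm_map] at h2
  linarith

end Main

end CoherentFrame

/-! ### The main theorem. -/

open CoherentFrame in
theorem theorem3p2
    {G : Type*} [Group G] [TopologicalSpace G] [IsTopologicalGroup G] [T2Space G]
    [LocallyCompactSpace G] [SecondCountableTopology G] [MeasurableSpace G] [BorelSpace G]
    (μ : Measure G) [μ.IsHaarMeasure] [μ.IsMulRightInvariant]
    {H : Type*} [NormedAddCommGroup H] [InnerProductSpace ℂ H] [CompleteSpace H]
    (π : CoherentFrame.ProjectiveRep G H) (hπ : π.IsDiscreteSeries μ)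
    (Q : Set G) (hQc : IsCompact Q) (hQs : Q⁻¹ = Q) (hQn : Q ∈ 𝓝 (1 : G))
    (K : ℕ → Set G) (hK : CoherentFrame.IsStrongFolner μ K)
    (hKc : CoherentFrame.IsNestedCover K)
    (Λ : Set G) (hΛ : DiscreteTopology Λ)
    (g : H) (hg : π.MemB2 μ Q g)
    (hframe : CoherentFrame.IsFrame (π.coherentSystem Λ g)) :
    ∃ d : ℝ, π.IsFormalDegree μ d ∧
      ∃ Dlow Dup : ℝ≥0, 0 < Dlow ∧ Dlow ≤ Dup ∧
        CoherentFrame.HasLowerBeurlingDensity μ Λ Dlow ∧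
        CoherentFrame.HasUpperBeurlingDensity μ Λ Dup ∧
        π.HasLowerFrameMeasure Λ g K (d / Dup) ∧
        π.HasUpperFrameMeasure Λ g K (d / Dlow) := by
  obtain ⟨d, hd⟩ := hπ.exists_isFormalDegree
  refine ⟨d, hd, ?_⟩
  have : Nontrivial H := by
    obtain ⟨-, u, hu, -⟩ := hπ
    exact nontrivial_of_ne u 0 hu
  have hΛc : Λ.Countable := Set.countable_coe_iff.1 countable_of_Lindelof_of_discrete
  have hg0 : g ≠ 0 := hframe.ne_zero
  obtain ⟨A, B, hA, hB, hlow, hbessel, hdual, hrec, hnorm⟩ := hframe.canonicalDual_spec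
  set h := canonicalDual (π.coherentSystem Λ g) with hh
  have hnorm' : ∀ l, ‖h l‖ ≤ A⁻¹ * ‖g‖ := fun l =>
    (hnorm l).trans_eq (by rw [ProjectiveRep.coherentSystem, LinearIsometryEquiv.norm_map])
  obtain ⟨U, hU, hUc, N, hN⟩ := exists_encard_inter_smul_le (μ := μ) hg0 hbessel
  have htail : ∀ ε > 0, ∃ C : Set G, IsCompact C ∧ ∀ (y : G) (v : Finset Λ),
      (∀ l ∈ v, (l : G) ∉ y • C) → ∑ l ∈ v, ‖inner ℂ (π l g) (π y g)‖ ^ 2 ≤ ε := fun ε hε =>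
    exists_isCompact_sum_norm_inner_sq_le hQn hg hU hUc hN hε
  have hDl := hasLowerBeurlingDensity μ hΛc
  have hDu := hasUpperBeurlingDensity μ hΛc
  have hle : lowerDensity μ Λ ≤ upperDensity μ Λ :=
    le_of_tendsto_of_tendsto' (hDl K hK) (hDu K hK) fun n => iInf_le_iSup
  have hupt : upperDensity μ Λ < ∞ := upperDensity_lt_top hU hUc hN
  have hlpos : 0 < lowerDensity μ Λ := by
    obtain ⟨C, hC, hCt⟩ := htail (A * ‖g‖ ^ 2 / 2) (by positivity)
    exact lowerDensity_pos hC (inter_smul_nonempty_of_tail hg0 hA hlow hCt)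
  obtain ⟨Dup, hDup⟩ : ∃ D : ℝ≥0, (D : ℝ≥0∞) = upperDensity μ Λ :=
    ⟨_, ENNReal.coe_toNNReal hupt.ne⟩
  obtain ⟨Dlow, hDlow⟩ : ∃ D : ℝ≥0, (D : ℝ≥0∞) = lowerDensity μ Λ :=
    ⟨_, ENNReal.coe_toNNReal (hle.trans_lt hupt).ne⟩
  rw [← hDup, ← hDlow] at hle
  rw [← hDlow] at hlpos hDl
  rw [← hDup] at hDu
  have hlow0 : 0 < Dlow := by exact_mod_cast hlpos
  have hlu : Dlow ≤ Dup := by exact_mod_cast hle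
  have hup0 : 0 < Dup := hlow0.trans_le hlu
  have hlow0' : (0 : ℝ) < Dlow := hlow0
  have hup0' : (0 : ℝ) < Dup := hup0
  refine ⟨Dlow, Dup, hlow0, hlu, hDl, hDu, ?_⟩
  have hfin : ∀ n (x : G), (Λ ∩ x • K n).Finite := fun n x =>
    finite_inter_smul μ hΛc hU hUc hN (hK.isCompact n) x
  have hfin' : ∀ n (x : G), (Subtype.val ⁻¹' (x • K n) : Set Λ).Finite := fun n x => by
    rw [← Subtype.preimage_coe_self_inter]
    exact (hfin n x).preimage Subtype.val_injective.injOn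
  have hKpos : ∀ n, 0 < μ.real (K n) := fun n =>
    ENNReal.toReal_pos (hK.measure_ne_zero n) (hK.isCompact n).measure_ne_top
  set s : ℕ → G → ℝ := fun n x => ((Λ ∩ x • K n).ncard : ℝ) / μ.real (K n) with hs
  set T : ℕ → G → ℝ := fun n x =>
    (∑ᶠ (l : Λ) (_ : (l : G) ∈ x • K n), (inner ℂ (h l) (π l g)).re) / μ.real (K n) with hT
  have hs0 : ∀ n x, 0 ≤ s n x := fun n x => by positivity
  -- Dividing numerator and count by `μ(Kₙ)` separates the trace, which tends uniformly to `d`, from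
  -- the normalized count, which carries the densities.
  have havg : ∀ n (x : G), π.frameAverage Λ g (x • K n) = T n x / s n x := fun n x =>
    (div_div_div_cancel_right₀ (hKpos n).ne' _ _).symm
  have hse : ∀ n (x : G), ((Λ ∩ x • K n).encard : ℝ≥0∞) / μ (K n) = ENNReal.ofReal (s n x) := by
    intro n x
    rw [hs, ENNReal.ofReal_div_of_pos (hKpos n), Measure.real,
      ENNReal.ofReal_toReal (hK.isCompact n).measure_ne_top, ← (hfin n x).cast_ncard_eq]
    simp
  have hlimU := hDu K hK
  have hlimL := hDl K hK
  simp only [hse] at hlimU hlimL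
  have hcard : ∀ n (x : G) (t : Finset Λ), (∀ l, l ∈ t ↔ (l : G) ∈ x • K n) →
      (t.card : ℝ) = s n x * μ.real (K n) := by
    intro n x t ht
    have h1 : (t : Set Λ) = Subtype.val ⁻¹' (x • K n) := Set.ext ht
    rw [hs, div_mul_cancel₀ _ (hKpos n).ne', ← Set.ncard_coe_finset, h1,
      ← Set.ncard_image_of_injective _ Subtype.val_injective, Subtype.image_preimage_coe]
  -- Any finite bound on the normalized count suffices here: it only multiplies the tail error. The
  -- tolerance `1` is arbitrary.
  have hcount : ∀ᶠ n in atTop, ∀ (x : G) (t : Finset Λ),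
      (∀ l, l ∈ t ↔ (l : G) ∈ x • K n) → (t.card : ℝ) ≤ (Dup + 1) * μ.real (K n) := by
    filter_upwards [(eventually_of_tendsto_iSup_ofReal hup0 hlimU one_pos).1] with n hn x t ht
    rw [hcard n x t ht]
    have := hn x
    have := hKpos n
    gcongr
  have hTd : ∀ ε > 0, ∀ᶠ n in atTop, ∀ x, |T n x - d| ≤ ε := by
    intro ε hε
    filter_upwards [eventually_abs_sum_re_inner_sub_le hK hd hΛc hg0 hA hB hbessel hdual hrec
      hnorm' hU hUc hN htail (κ := Dup + 1) (by positivity) hcount hε] with n hn x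
    have h1 := hn x (hfin' n x).toFinset fun l => by simp
    have h2 : ∑ᶠ (l : Λ) (_ : (l : G) ∈ x • K n), (inner ℂ (h l) (π l g)).re
        = ∑ l ∈ (hfin' n x).toFinset, (inner ℂ (h l) (π l g)).re :=
      finsum_mem_eq_finite_toFinset_sum _ (hfin' n x)
    have h3 : T n x - d
        = (∑ l ∈ (hfin' n x).toFinset, (inner ℂ (h l) (π l g)).re - d * μ.real (K n))
          / μ.real (K n) := by
      rw [← h2, sub_div, mul_div_cancel_right₀ _ (hKpos n).ne']
    rw [h3, abs_div, abs_of_pos (hKpos n), div_le_iff₀ (hKpos n)]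
    exact h1
  have hpos : ∀ᶠ n in atTop, ∀ x, 0 < s n x := by
    filter_upwards [(eventually_of_tendsto_iInf_ofReal hlow0 hs0 hlimL
      (half_pos hlow0')).1] with n hn x
    linarith [hn x]
  constructor
  · simp only [ProjectiveRep.HasLowerFrameMeasure, havg]
    exact tendsto_iInf_div hd.1 hup0' hTd hpos
      (fun ε hε => (eventually_of_tendsto_iSup_ofReal hup0 hlimU hε).1)
      (fun ε hε => (eventually_of_tendsto_iSup_ofReal hup0 hlimU hε).2)
  · simp only [ProjectiveRep.HasUpperFrameMeasure, havg]
    exact tendsto_iSup_div hd.1 hlow0' hTd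
      (fun ε hε => (eventually_of_tendsto_iInf_ofReal hlow0 hs0 hlimL hε).1)
      (fun ε hε => (eventually_of_tendsto_iInf_ofReal hlow0 hs0 hlimL hε).2)
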